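/- **Definitions.** Let $M$ be an $n$-dimensional complex manifold (Hausdorff, second countable) with a positive definite Kähler metric $g_{\alpha\bar\beta}$ and Kähler form $\mathcal K=\frac{i}{2\pi}g_{\alpha\bar\beta}\,dz^\alpha\wedge d\bar z^\beta$; a smooth real function $K$ on an open set is a Kähler potential if $g_{\alpha\bar\beta}=\partial_\alpha\partial_{\bar\beta}K$ there. $(M,g)$ is *Hodge–Kähler* if the cohomology class of $\mathcal K$ is an even integer class. On $\mathbb C^{2n+2}$ put $\langle v,w\rangle=v^T\Omega w$ with $\Omega=\begin{pmatrix}0&1\\-1&0\end{pmatrix}$, and let $Sp(2n+2,\mathbb R)$ be the group of real matrices preserving $\langle\cdot,\cdot\rangle$. *Transition functions* over an open cover $(U_i)$ are holomorphic functions $f_{ij}$ on $U_i\cap U_j$ and constant matrices $S_{ij}\in Sp(2n+2,\mathbb R)$ with $e^{f_{ij}}e^{f_{jk}}=e^{f_{ik}}$ and $S_{ij}S_{jk}=S_{ik}$ on nonempty triple overlaps; they define a holomorphic line bundle $\mathcal L$, a flat symplectic bundle $\mathcal H$, and $\mathcal L\otimes\mathcal H$. Vectors $v_i:U_i\to\mathbb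 C^{2n+2}$ represent a section of $\mathcal L\otimes\mathcal H$ if $v_i=e^{f_{ij}}S_{ij}v_j$ on overlaps. *Prepotential chart.* A holomorphic chart with coordinates $z^\alpha$ on an open set $U$, holomorphic functions $Z^0,\dots,Z^n$ on $U$ which are projective coordinates (the $(n+1)\times(n+1)$ matrix with rows $Z^I$ and $\partial_\alpha Z^I$ is invertible at every point, and $z\mapsto[Z^0(z):\dots:Z^n(z)]$ is injective), and a holomorphic function $F$ on an open set $D\subseteq\mathbb C^{n+1}$ that is stable under $\mathbb C^*$ and contains all values of $Z$, with $F(\lambda X)=\lambda^2F(X)$ for $X\in D$, $\lambda\in\mathbb C^*$, such that $i\bar Z^I\partial_IF(Z)-iZ^I\overline{\partial_IF(Z)}>0$ and $$K=-\log\bigl[i\bar Z^I\partial_IF(Z)-iZ^I\overline{\partial_IF(Z)}\bigr]$$ is a Kähler potential on $U$. *Symplectic section on an open set $U$.* A holomorphic $v:U\to\mathbb C^{2n+2}$ such that $i\langle\bar v,v\rangle>0$, $K=-\log(i\langle\bar v,v\rangle)$ is a Kähler potential on $U$, and $\langle v,\partial_\alpha v\rangle=0$ in all holomorphic coordinates.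 *Definition 1.* $(M,g)$ is special Kähler in the prepotential sense if it is Hodge–Kähler and has a *prepotential model*: a cover of $M$ by prepotential charts $(U_i,Z_i,F_i)$ and transition functions over $(U_i)$ with which the vectors $(Z^I,\partial_IF(Z))_{(i)}$ satisfy $\begin{pmatrix}Z\\\partial F\end{pmatrix}_{(i)}=e^{f_{ij}}S_{ij}\begin{pmatrix}Z\\\partial F\end{pmatrix}_{(j)}$. *Definition 2.* $(M,g)$ is special Kähler in the sense of a symplectic section if it is Hodge–Kähler and has a *symplectic model*: an open cover $(U_i)$ with transition functions and a section of $\mathcal L\otimes\mathcal H$ whose representatives $v_i$ are symplectic sections on $U_i$, where $\mathcal L$ is the line bundle of the Kähler transformations, $K_i=K_j-f_{ij}-\bar f_{ij}$ for $K_i=-\log(i\langle\bar v_i,v_i\rangle)$ (so that the first Chern class of $\mathcal L$, oriented as the line spanned by $v$, is the class of $\mathcal K$). **Theorem.** Let $M$ be an $n$-dimensional complex manifold (Hausdorff, second countable) with a positive definite Kähler metric $g$. 1. $(M,g)$ satisfies Definition 1 if and only if it satisfies Definition 2. 2. Let $v$ be a symplectic section on an open set $U\subseteq M$ and $p\in U$.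 Then there are a matrix $S\in Sp(2n+2,\mathbb R)$ and a prepotential chart $(W,X,F)$ with $p\in W\subseteq U$ such that $Sv=(X^I,\partial F/\partial X^I)$ on $W$. 3. Every symplectic model is a symplectic rotation of a prepotential model: given a symplectic model with data $(U_k,v_k,f_{kl},S_{kl})$, there is a prepotential model with charts $(W_i,Z_i,F_i)$ and transition functions $(f'_{ij},S'_{ij})$, and for every $i$ an index $a(i)$ and a constant matrix $R_i\in Sp(2n+2,\mathbb R)$, such that $W_i\subseteq U_{a(i)}$ and $(Z,\partial F)_{(i)}=R_iv_{a(i)}$ on $W_i$, and whenever $W_i\cap W_j\neq\emptyset$, $S'_{ij}=R_iS_{a(i)a(j)}R_j^{-1}$ and $f'_{ij}=f_{a(i)a(j)}$ on $W_i\cap W_j$. 4. Conversely, for every prepotential model the same cover, the vectors $v_i=(Z^I,\partial_IF(Z))_{(i)}$ and the same transition functions form a symplectic model. -/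

import Mathlib

open scoped Manifold ContDiff

noncomputable section

namespace SpecialGeometry

universe u

/-- The model space `ℂⁿ` of an `n`-dimensional complex manifold. -/
abbrev Model (n : ℕ) : Type := Fin n → ℂ

/-! ### Complex coordinate derivatives -/

/-- The Wirtinger derivative `∂f/∂z^α`. -/
def wirtinger {n : ℕ} (α : Fin n) (f : Model n → ℂ) (z : Model n) : ℂ :=
  (1 / 2 : ℂ) * (fderiv ℝ f z (Pi.single α 1) - Complex.I * fderiv ℝ f z (Pi.single α Complex.I))

/-- The conjugate Wirtinger derivative `∂f/∂z̄^α`. -/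
def wirtingerBar {n : ℕ} (α : Fin n) (f : Model n → ℂ) (z : Model n) : ℂ :=
  (1 / 2 : ℂ) * (fderiv ℝ f z (Pi.single α 1) + Complex.I * fderiv ℝ f z (Pi.single α Complex.I))

section Manifolds

variable {n : ℕ} {M : Type u} [TopologicalSpace M] [ChartedSpace (Model n) M]

/-- The holomorphic charts of the complex manifold `M`. -/
def IsHolomorphicChart (e : OpenPartialHomeomorph M (Model n)) : Prop :=
  e ∈ IsManifold.maximalAtlas 𝓘(ℂ, Model n) ω M

/-- A holomorphic map on `U` with values in a complex normed space. -/
def HolomorphicOn {V : Type*} [NormedAddCommGroup V] [NormedSpace ℂ V]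
    (f : M → V) (U : Set M) : Prop :=
  MDifferentiableOn 𝓘(ℂ, Model n) 𝓘(ℂ, V) f U

/-- The derivative `∂_α f` of a holomorphic map in the coordinates given by the chart `e`. -/
def coordDeriv {V : Type*} [NormedAddCommGroup V] [NormedSpace ℂ V]
    (e : OpenPartialHomeomorph M (Model n)) (α : Fin n) (f : M → V) (x : M) : V :=
  fderiv ℂ (f ∘ e.symm) (e x) (Pi.single α 1)

/-! ### Kähler and Hodge–Kähler manifolds -/

/-- The components `h(∂_α, ∂̄_β)` of a family of sesquilinear forms on the (holomorphic) tangent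
spaces, in the chart `e` and at the point with coordinates `z`. -/
def hermComponent
    (h : ∀ x : M, TangentSpace 𝓘(ℂ, Model n) x →ₗ[ℂ] TangentSpace 𝓘(ℂ, Model n) x →ₗ⋆[ℂ] ℂ)
    (e : OpenPartialHomeomorph M (Model n)) (α β : Fin n) (z : Model n) : ℂ :=
  h (e.symm z)
    (mfderiv 𝓘(ℂ, Model n) 𝓘(ℂ, Model n) e.symm z (Pi.single α 1 : Model n))
    (mfderiv 𝓘(ℂ, Model n) 𝓘(ℂ, Model n) e.symm z (Pi.single β 1 : Model n))

variable (n M) in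
/-- A (positive definite) Kähler metric: a smooth Hermitian metric `g_{αβ̄}` on the holomorphic
tangent bundle whose fundamental form `(i/2π) g_{αβ̄} dz^α ∧ dz̄^β` is closed. -/
structure KahlerMetric where
  form : ∀ x : M, TangentSpace 𝓘(ℂ, Model n) x →ₗ[ℂ] TangentSpace 𝓘(ℂ, Model n) x →ₗ⋆[ℂ] ℂ
  hermitian : ∀ x v w, form x v w = (starRingEnd ℂ) (form x w v)
  posDef : ∀ x v, v ≠ 0 → 0 < (form x v v).re
  smooth : ∀ e : OpenPartialHomeomorph M (Model n), IsHolomorphicChart e →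
    ∀ α β, ContDiffOn ℝ ∞ (hermComponent form e α β) e.target
  closed : ∀ e : OpenPartialHomeomorph M (Model n), IsHolomorphicChart e →
    ∀ α β γ, ∀ z ∈ e.target,
      wirtinger γ (hermComponent form e α β) z = wirtinger α (hermComponent form e γ β) z

/-- `K` is a (smooth, real) Kähler potential of `g` on `U`: `g_{αβ̄} = ∂_α ∂_β̄ K` in all
holomorphic coordinates, i.e. the Kähler form is `(i/2π) ∂∂̄K` on `U`. -/
def KahlerMetric.IsPotential (g : KahlerMetric n M) (U : Set M) (K : M → ℝ) : Prop :=
  ∀ e : OpenPartialHomeomorph M (Model n), IsHolomorphicChart e →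
    ContDiffOn ℝ ∞ (K ∘ e.symm) (e.target ∩ e.symm ⁻¹' U) ∧
    ∀ z ∈ e.target ∩ e.symm ⁻¹' U, ∀ α β,
      hermComponent g.form e α β z =
        wirtinger α (wirtingerBar β fun w => (K (e.symm w) : ℂ)) z

/-- The Kähler form of `g` has even integer cohomology class (Hodge–Kähler manifold).
The de Rham class of `(i/2π) ∂∂̄K_i` is expressed by its Čech cocycle: if
`K_i - K_j = f_ij + f̄_ij` with `f_ij` holomorphic, then `-(i/2π) ∂K_i` are local primitives, their
differences are the differentials of `-(i/2π) f_ij`, and the class is that of the locally constant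
cocycle `-(i/2π) (f_ij + f_jk - f_ik)`, which for suitable choices has to lie in `2ℤ`. -/
def KahlerMetric.IsHodge (g : KahlerMetric n M) : Prop :=
  ∃ (ι : Type u) (U : ι → Set M) (K : ι → M → ℝ) (f : ι → ι → M → ℂ),
    (∀ i, IsOpen (U i)) ∧ (∀ x, ∃ i, x ∈ U i) ∧
    (∀ i, g.IsPotential (U i) (K i)) ∧
    (∀ i j, HolomorphicOn (n := n) (f i j) (U i ∩ U j)) ∧
    (∀ i j, ∀ x ∈ U i ∩ U j,
      ((K i x - K j x : ℝ) : ℂ) = f i j x + (starRingEnd ℂ) (f i j x)) ∧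
    ∀ i j k, ∀ x ∈ U i ∩ U j ∩ U k, ∃ m : ℤ,
      -(Complex.I / (2 * Real.pi)) * (f i j x + f j k x - f i k x) = 2 * (m : ℂ)

/-! ### Symplectic vectors -/

/-- Complex symplectic vectors `(X^I, Y_I)`, `I = 0, …, n`. -/
abbrev SympVec (n : ℕ) : Type := Fin (n + 1) ⊕ Fin (n + 1) → ℂ

/-- The group `Sp(2n+2, ℝ)`. -/
abbrev Sp (n : ℕ) : Type := Matrix.symplecticGroup (Fin (n + 1)) ℝ

/-- The action of a real symplectic matrix on complex symplectic vectors. -/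
def rotate {n : ℕ} (S : Sp n) (v : SympVec n) : SympVec n :=
  ((S : Matrix (Fin (n + 1) ⊕ Fin (n + 1)) (Fin (n + 1) ⊕ Fin (n + 1)) ℝ).map
    Complex.ofReal).mulVec v

/-- The symplectic inner product `⟨v, w⟩ = vᵀ Ω w` with `Ω = (0 1; -1 0)`. -/
def sympInner {n : ℕ} (v w : SympVec n) : ℂ :=
  dotProduct v ((Matrix.fromBlocks 0 1 (-1) 0 :
    Matrix (Fin (n + 1) ⊕ Fin (n + 1)) (Fin (n + 1) ⊕ Fin (n + 1)) ℂ).mulVec w)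

/-- The real number `i⟨v̄, v⟩`. -/
def sympNorm {n : ℕ} (v : SympVec n) : ℝ := (Complex.I * sympInner (star v) v).re

/-- The data of a flat `Sp(2n+2, ℝ)` vector bundle `ℋ` (constant transition matrices `S_ij`) and of
a holomorphic line bundle `ℒ` (transition functions `e^{f_ij}`), both over the open cover `U`.
The tensor product `ℒ ⊗ ℋ` has the transition functions `e^{f_ij} S_ij`. -/
structure SymplecticBundle {ι : Type u} (U : ι → Set M) where
  f : ι → ι → M → ℂ
  S : ι → ι → Sp n
  holomorphic : ∀ i j, HolomorphicOn (n := n) (f i j) (U i ∩ U j)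
  cocycle_f : ∀ i j k, ∀ x ∈ U i ∩ U j ∩ U k,
    Complex.exp (f i j x) * Complex.exp (f j k x) = Complex.exp (f i k x)
  cocycle_S : ∀ i j k, (U i ∩ U j ∩ U k).Nonempty → S i j * S j k = S i k

/-- The vectors `v_i` are the local representatives of one section of `ℒ ⊗ ℋ`. -/
def SymplecticBundle.Glues {ι : Type u} {U : ι → Set M} (B : SymplecticBundle (n := n) U)
    (v : ι → M → SympVec n) : Prop :=
  ∀ i j, ∀ x ∈ U i ∩ U j, v i x = Complex.exp (B.f i j x) • rotate (B.S i j) (v j x)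

/-! ### Definition through a symplectic section -/

/-- `v` represents on `U` a holomorphic symplectic section with Kähler potential
`K = -log (i⟨v̄, v⟩)` and `⟨v, ∂_α v⟩ = 0`. -/
structure IsSymplecticSection (g : KahlerMetric n M) (U : Set M) (v : M → SympVec n) : Prop where
  holomorphic : HolomorphicOn (n := n) v U
  norm_pos : ∀ x ∈ U, 0 < sympNorm (v x)
  potential : g.IsPotential U fun x => -Real.log (sympNorm (v x))
  inner_deriv : ∀ e : OpenPartialHomeomorph M (Model n), IsHolomorphicChart e →
    ∀ x ∈ e.source ∩ U, ∀ α, sympInner (v x) (coordDeriv e α v x) = 0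

/-- A holomorphic section `v` of some bundle `ℒ ⊗ ℋ` which locally satisfies
`IsSymplecticSection`. The field `kahler_transf` expresses that `ℒ` is the line bundle of the
Kähler transformations between the potentials of the Kähler form, so that (in the orientation
of the transition functions fixed by `v_i = e^{f_ij} S_ij v_j`, in which `ℒ` is spanned by `v`)
its first Chern class is the class of the Kähler form. -/
structure SymplecticModel (g : KahlerMetric n M) where
  ι : Type u
  U : ι → Set M
  isOpen : ∀ i, IsOpen (U i)
  cover : ∀ x, ∃ i, x ∈ U i
  bundle : SymplecticBundle (n := n) U
  v : ι → M → SympVec n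
  glues : bundle.Glues v
  isSection : ∀ i, IsSymplecticSection g (U i) (v i)
  kahler_transf : ∀ i j, ∀ x ∈ U i ∩ U j,
    -Real.log (sympNorm (v i x)) = -Real.log (sympNorm (v j x)) - 2 * (bundle.f i j x).re

/-- Special Kähler manifold, in the sense of a symplectic section. -/
def IsSpecialBySection (g : KahlerMetric n M) : Prop :=
  g.IsHodge ∧ Nonempty (SymplecticModel g)

/-! ### Definition through a prepotential -/

/-- The partial derivative `∂F/∂Z^I`. -/
def partialF {n : ℕ} (F : (Fin (n + 1) → ℂ) → ℂ) (I : Fin (n + 1)) (Z : Fin (n + 1) → ℂ) : ℂ :=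
  fderiv ℂ F Z (Pi.single I 1)

/-- `F` is a holomorphic function on the open conic set `D`, homogeneous of degree two. -/
structure IsHomogeneousPrepotential {n : ℕ} (D : Set (Fin (n + 1) → ℂ))
    (F : (Fin (n + 1) → ℂ) → ℂ) : Prop where
  isOpen : IsOpen D
  cone : ∀ Z ∈ D, ∀ c : ℂ, c ≠ 0 → c • Z ∈ D
  holomorphic : DifferentiableOn ℂ F D
  homogeneous : ∀ Z ∈ D, ∀ c : ℂ, c ≠ 0 → F (c • Z) = c ^ 2 * F Z

/-- `Z^0, …, Z^n` are holomorphic and are projective (homogeneous) coordinates on the domain of the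
chart `e`: `x ↦ [Z^0(x) : … : Z^n(x)]` is injective and an immersion. -/
structure IsProjectiveCoordinates (e : OpenPartialHomeomorph M (Model n))
    (Z : M → Fin (n + 1) → ℂ) : Prop where
  holomorphic : HolomorphicOn (n := n) Z e.source
  det_ne_zero : ∀ x ∈ e.source,
    (Matrix.of (Fin.cons (Z x) fun α : Fin n => coordDeriv e α Z x) :
      Matrix (Fin (n + 1)) (Fin (n + 1)) ℂ).det ≠ 0
  injective : ∀ x ∈ e.source, ∀ y ∈ e.source, ∀ c : ℂ, Z x = c • Z y → x = y

/-- The number `i Z̄^I ∂_I F(Z) - i Z^I ∂_Ī F̄(Z̄)` (it is real). -/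
def prepotentialNorm {n : ℕ} (F : (Fin (n + 1) → ℂ) → ℂ) (Z : Fin (n + 1) → ℂ) : ℝ :=
  (Complex.I * ∑ I, (starRingEnd ℂ) (Z I) * partialF F I Z
    - Complex.I * ∑ I, Z I * (starRingEnd ℂ) (partialF F I Z)).re

/-- The symplectic vector `(Z^I, ∂F/∂Z^I)`. -/
def prepotentialVec {n : ℕ} (F : (Fin (n + 1) → ℂ) → ℂ) (Z : Fin (n + 1) → ℂ) : SympVec n :=
  Sum.elim Z fun I => partialF F I Z

/-- On the holomorphic chart `e`, the metric comes from the projective coordinates `Z` and the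
prepotential `F` (defined on `D`). -/
structure IsPrepotentialChart (g : KahlerMetric n M) (e : OpenPartialHomeomorph M (Model n))
    (Z : M → Fin (n + 1) → ℂ) (D : Set (Fin (n + 1) → ℂ)) (F : (Fin (n + 1) → ℂ) → ℂ) : Prop where
  chart : IsHolomorphicChart e
  coordinates : IsProjectiveCoordinates e Z
  prepotential : IsHomogeneousPrepotential D F
  mapsTo : ∀ x ∈ e.source, Z x ∈ D
  norm_pos : ∀ x ∈ e.source, 0 < prepotentialNorm F (Z x)
  potential : g.IsPotential e.source fun x => -Real.log (prepotentialNorm F (Z x))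

/-- An atlas of charts with projective coordinates `Z_i` and prepotentials `F_i`, such that the
vectors `(Z, ∂F)_i` are related by transition functions `e^{f_ij} S_ij` satisfying the cocycle
condition. -/
structure PrepotentialModel (g : KahlerMetric n M) where
  ι : Type u
  chart : ι → OpenPartialHomeomorph M (Model n)
  cover : ∀ x, ∃ i, x ∈ (chart i).source
  Z : ι → M → Fin (n + 1) → ℂ
  D : ι → Set (Fin (n + 1) → ℂ)
  F : ι → (Fin (n + 1) → ℂ) → ℂ
  isPrepotential : ∀ i, IsPrepotentialChart g (chart i) (Z i) (D i) (F i)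
  bundle : SymplecticBundle (n := n) fun i => (chart i).source
  glues : bundle.Glues fun i x => prepotentialVec (F i) (Z i x)

/-- Special Kähler manifold, in the sense of a prepotential. -/
def IsSpecialByPrepotential (g : KahlerMetric n M) : Prop :=
  g.IsHodge ∧ Nonempty (PrepotentialModel g)

end Manifolds

end SpecialGeometry

end

/-! From a prepotential to a section: `F` has degree two, so `∂_I F` has degree one. Euler's
relation for `∂_I F` together with the symmetry of second derivatives gives `⟨v, ∂_α v⟩ = 0` for `v
= (Z, ∂F)`. The expression inside the logarithm is `i⟨v̄, v⟩`, so the potentials agree, and the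
cover and the transition functions are kept.

From a section to a prepotential: positivity of the metric forces `v, ∂_1 v, …, ∂_n v` to be
linearly independent (`IsSymplecticSection.linearIndependent`). Differentiating `⟨v, ∂_α v⟩ = 0`
shows that they span an isotropic, hence Lagrangian, subspace (`sympInner_fderiv_fderiv_eq_zero`). A
Lagrangian subspace is a graph over the `X`-space after some of the pairs `(X^I, Y_I)` are exchanged
(`exists_det_rotate_ne_zero`). After this constant rotation the `X^I` are projective coordinates
near the point, by the inverse function theorem. Euler's relation then leaves only one candidate, `F
= ½ X^I Y_I` extended with degree two, and horizontality of `v` says precisely that `∂_I F = Y_I`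
(`exists_prepotential`).

Globally, one such chart is taken around every point. The rotations `R_i` are constant, so `R_i S
R_j⁻¹` is again a constant cocycle and the functions `f` do not change. The Hodge condition is
common to both definitions. -/

namespace SpecialGeometry

universe u

/-! ### Smoothness of holomorphic maps in several complex variables. -/

section SeveralComplexVariables

open Metric Complex

variable {E F : Type*} [NormedAddCommGroup E] [NormedSpace ℂ E]
  [NormedAddCommGroup F] [NormedSpace ℂ F]

/-- Cauchy's estimate on the complex line `ζ ↦ z + ζu`. The disc of radius `r / (2‖u‖)` stays,
closure included, inside the ball, which costs the factor 2. -/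
theorem norm_fderiv_le_of_forall_mem_ball [CompleteSpace F] {f : E → F} {z : E} {r C : ℝ}
    (hr : 0 < r) (hf : DifferentiableOn ℂ f (ball z r)) (hC : ∀ w ∈ ball z r, ‖f w‖ ≤ C) :
    ‖fderiv ℂ f z‖ ≤ 2 * C / r := by
  have hC0 : 0 ≤ C := (norm_nonneg _).trans (hC z (mem_ball_self hr))
  refine ContinuousLinearMap.opNorm_le_bound _ (by positivity) fun u => ?_
  rcases eq_or_ne u 0 with rfl | hu
  · simp
  have hu' : 0 < ‖u‖ := norm_pos_iff.mpr hu
  set ρ : ℝ := r / (2 * ‖u‖) with hρ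
  have hρ0 : 0 < ρ := by positivity
  have hmem : ∀ ζ ∈ closedBall (0 : ℂ) ρ, z + ζ • u ∈ ball z r := by
    intro ζ hζ
    rw [mem_closedBall_zero_iff] at hζ
    rw [mem_ball_iff_norm, add_sub_cancel_left, norm_smul]
    calc ‖ζ‖ * ‖u‖ ≤ ρ * ‖u‖ := by gcongr
      _ = r / 2 := by rw [hρ]; field_simp
      _ < r := by linarith
  have hlin : Differentiable ℂ fun ζ : ℂ => z + ζ • u := by fun_prop
  have hd : DifferentiableOn ℂ (fun ζ : ℂ => f (z + ζ • u)) (closedBall 0 ρ) :=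
    hf.comp hlin.differentiableOn hmem
  have hder : deriv (fun ζ : ℂ => f (z + ζ • u)) 0 = fderiv ℂ f z u :=
    (hf.differentiableAt (ball_mem_nhds z hr)).lineDeriv_eq_fderiv
  rw [← hder]
  calc _ ≤ C / ρ := norm_deriv_le_of_forall_mem_sphere_norm_le hρ0
        (hd.diffContOnCl_ball subset_rfl)
        fun ζ hζ => hC _ (hmem ζ (sphere_subset_closedBall hζ))
    _ = _ := by rw [hρ]; field_simp

/-- Cauchy's formula for the derivative of `ζ ↦ f (z + ζe)` at 0. On the right `z` is a mere
parameter of the integrand, so the formula can be differentiated in `z`. -/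
theorem fderiv_apply_eq_integral [CompleteSpace F] {f : E → F} {z e : E} {r : ℝ} (hr : 0 < r)
    {s : Set E} (hs : IsOpen s) (hf : DifferentiableOn ℂ f s)
    (hmem : ∀ ζ ∈ closedBall (0 : ℂ) r, z + ζ • e ∈ s) :
    fderiv ℂ f z e = (2 * Real.pi * I : ℂ)⁻¹ • ∫ θ in Set.Ioc 0 (2 * Real.pi),
      (deriv (circleMap 0 r) θ * ((circleMap 0 r θ) ^ 2)⁻¹) • f (z + circleMap 0 r θ • e) := by
  have hlin : Differentiable ℂ fun ζ : ℂ => z + ζ • e := by fun_prop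
  have hd : DifferentiableOn ℂ (fun ζ : ℂ => f (z + ζ • e)) ((fun ζ : ℂ => z + ζ • e) ⁻¹' s) :=
    hf.comp hlin.differentiableOn fun _ h => h
  have hder : deriv (fun ζ : ℂ => f (z + ζ • e)) 0 = fderiv ℂ f z e := by
    have hz : z ∈ s := by simpa using hmem 0 (by simpa using hr.le)
    have h1 : HasFDerivAt f (fderiv ℂ f z) (z + (0 : ℂ) • e) := by
      simpa using (hf.differentiableAt (hs.mem_nhds hz)).hasFDerivAt
    have h2 : HasDerivAt (fun ζ : ℂ => z + ζ • e) e 0 := by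
      simpa using ((hasDerivAt_id (0 : ℂ)).smul_const e).const_add z
    exact (h1.comp_hasDerivAt (0 : ℂ) h2).deriv
  rw [← hder, ← Complex.two_pi_I_inv_smul_circleIntegral_sub_sq_inv_smul_of_differentiable
    (hs.preimage hlin.continuous) hmem hd (mem_ball_self hr), circleIntegral,
    intervalIntegral.integral_of_le (by positivity)]
  simp only [sub_zero, smul_smul]

/-- Cauchy's integral is differentiated under the integral sign. The domination comes from a
Lipschitz bound on `f` near `z₀`, which local boundedness and Cauchy's estimate supply. -/
theorem differentiableAt_fderiv_apply [FiniteDimensional ℂ E] [FiniteDimensional ℂ F]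
    {f : E → F} {s : Set E} (hs : IsOpen s) (hf : DifferentiableOn ℂ f s) {z₀ : E} (hz₀ : z₀ ∈ s)
    (e : E) : DifferentiableAt ℂ (fun z => fderiv ℂ f z e) z₀ := by
  have : CompleteSpace F := FiniteDimensional.complete ℂ F
  obtain ⟨R₁, hR₁, hR₁s⟩ := Metric.isOpen_iff.mp hs z₀ hz₀
  have hcont : ContinuousAt f z₀ := (hf.differentiableAt (hs.mem_nhds hz₀)).continuousAt
  obtain ⟨R₂, hR₂, hR₂f⟩ := Metric.continuousAt_iff.mp hcont 1 one_pos
  set R := min R₁ R₂ with hRdef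
  have hR : 0 < R := lt_min hR₁ hR₂
  have hRs : ball z₀ R ⊆ s := (ball_subset_ball (min_le_left _ _)).trans hR₁s
  set C := ‖f z₀‖ + 1
  have hC : ∀ w ∈ ball z₀ R, ‖f w‖ ≤ C := by
    intro w hw
    have h1 : dist (f w) (f z₀) < 1 := hR₂f (lt_of_lt_of_le hw (min_le_right _ _))
    rw [dist_eq_norm] at h1
    have h2 : ‖f w‖ ≤ ‖f z₀‖ + ‖f w - f z₀‖ := norm_le_norm_add_norm_sub' _ _
    exact h2.trans (add_le_add_right h1.le _)
  have hfd : ∀ w ∈ ball z₀ (R / 2), ‖fderiv ℂ f w‖ ≤ 2 * C / (R / 2) := by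
    intro w hw
    have hsub : ball w (R / 2) ⊆ ball z₀ R := ball_subset_ball' (by
      rw [mem_ball] at hw; linarith)
    exact norm_fderiv_le_of_forall_mem_ball (half_pos hR) (hf.mono (hsub.trans hRs))
      fun x hx => hC x (hsub hx)
  obtain ⟨r, hr, hre⟩ : ∃ r : ℝ, 0 < r ∧ r * ‖e‖ < R / 4 := by
    refine ⟨R / 8 / (‖e‖ + 1), by positivity, ?_⟩
    rw [div_mul_eq_mul_div, div_lt_iff₀ (by positivity)]
    nlinarith [norm_nonneg e]
  have hmem : ∀ z ∈ ball z₀ (R / 4), ∀ ζ ∈ closedBall (0 : ℂ) r, z + ζ • e ∈ ball z₀ (R / 2) := by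
    intro z hz ζ hζ
    rw [mem_closedBall_zero_iff] at hζ
    rw [mem_ball_iff_norm] at hz ⊢
    calc ‖z + ζ • e - z₀‖ = ‖(z - z₀) + ζ • e‖ := by congr 1; abel
      _ ≤ ‖z - z₀‖ + ‖ζ‖ * ‖e‖ := (norm_add_le _ _).trans_eq (by rw [norm_smul])
      _ ≤ ‖z - z₀‖ + r * ‖e‖ := by gcongr
      _ < R / 2 := by linarith
  have hcirc : ∀ θ : ℝ, circleMap 0 r θ ∈ closedBall (0 : ℂ) r := fun θ =>
    circleMap_mem_closedBall 0 hr.le θ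
  have hhalf : ball z₀ (R / 2) ⊆ s := (ball_subset_ball (by linarith)).trans hRs
  set k : ℝ → ℂ := fun θ => deriv (circleMap 0 r) θ * ((circleMap 0 r θ) ^ 2)⁻¹ with hk
  have hkc : Continuous k := by
    have h0 : ∀ θ, circleMap 0 r θ ^ 2 ≠ 0 := fun θ =>
      pow_ne_zero 2 (circleMap_ne_center hr.ne')
    simp only [hk, deriv_circleMap]
    exact ((continuous_circleMap 0 r).mul continuous_const).mul
      (((continuous_circleMap 0 r).pow 2).inv₀ h0)
  have hFc : ∀ z ∈ ball z₀ (R / 4), Continuous fun θ => k θ • f (z + circleMap 0 r θ • e) := by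
    intro z hz
    refine hkc.smul (hf.continuousOn.comp_continuous (by fun_prop) fun θ =>
      hhalf (hmem z hz _ (hcirc θ)))
  have hLip : LipschitzOnWith (Real.nnabs (2 * C / (R / 2))) f (ball z₀ (R / 2)) := by
    refine (convex_ball z₀ (R / 2)).lipschitzOnWith_of_nnnorm_fderiv_le (𝕜 := ℂ)
      (fun x hx => hf.differentiableAt (hs.mem_nhds (hhalf hx))) fun x hx => ?_
    rw [← NNReal.coe_le_coe, Real.coe_nnabs]
    exact (hfd x hx).trans (le_abs_self _)
  have hz₀' : z₀ ∈ ball z₀ (R / 4) := mem_ball_self (by linarith)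
  have key := hasFDerivAt_integral_of_dominated_loc_of_lip (𝕜 := ℂ)
    (μ := MeasureTheory.volume.restrict (Set.Ioc 0 (2 * Real.pi)))
    (F := fun z θ => k θ • f (z + circleMap 0 r θ • e))
    (F' := fun θ => k θ • fderiv ℂ f (z₀ + circleMap 0 r θ • e))
    (bound := fun θ => ‖k θ‖ * |2 * C / (R / 2)|) (x₀ := z₀) (s := ball z₀ (R / 4))
    (ball_mem_nhds z₀ (by linarith)) ?_ ?_ ?_ ?_ ?_ ?_
  · refine DifferentiableAt.congr_of_eventuallyEq
      (f := fun z => (2 * Real.pi * I : ℂ)⁻¹ • ∫ θ in Set.Ioc 0 (2 * Real.pi),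
        k θ • f (z + circleMap 0 r θ • e)) (key.2.differentiableAt.const_smul _) ?_
    filter_upwards [ball_mem_nhds z₀ (by linarith : 0 < R / 4)] with z hz
    exact fderiv_apply_eq_integral hr hs hf fun ζ hζ => hhalf (hmem z hz ζ hζ)
  · filter_upwards [ball_mem_nhds z₀ (by linarith : 0 < R / 4)] with z hz
    exact (hFc z hz).aestronglyMeasurable
  · exact (hFc z₀ hz₀').integrableOn_Ioc
  -- Continuity of `fderiv ℂ f` is not yet known at this stage; its measurability is enough.
  · borelize E
    borelize (E →L[ℂ] F)
    have : ProperSpace (E →L[ℂ] F) := FiniteDimensional.proper ℂ _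
    have h1 : Measurable fun θ : ℝ => fderiv ℂ f (z₀ + circleMap 0 r θ • e) :=
      (measurable_fderiv ℂ f).comp (Continuous.measurable (by fun_prop))
    exact (hkc.aestronglyMeasurable.smul h1.aestronglyMeasurable)
  · refine Filter.Eventually.of_forall fun θ => ?_
    refine LipschitzOnWith.of_dist_le_mul fun x hx y hy => ?_
    rw [dist_eq_norm, dist_eq_norm]
    rw [← smul_sub, norm_smul]
    have h1 := hLip.norm_sub_le (hmem x hx _ (hcirc θ)) (hmem y hy _ (hcirc θ))
    rw [add_sub_add_right_eq_sub] at h1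
    calc _ ≤ ‖k θ‖ * (Real.nnabs (2 * C / (R / 2)) * ‖x - y‖) := by gcongr
      _ = _ := by simp [mul_assoc]
  · exact (hkc.norm.mul continuous_const).integrableOn_Ioc
  · refine Filter.Eventually.of_forall fun θ => ?_
    have h1 := (hf.differentiableAt (hs.mem_nhds (hhalf (hmem z₀ hz₀' _ (hcirc θ))))).hasFDerivAt
    have h2 : HasFDerivAt (fun z => z + circleMap 0 r θ • e) (ContinuousLinearMap.id ℂ E) z₀ :=
      (hasFDerivAt_id z₀).add_const _
    exact (h1.comp z₀ h2).const_smul (k θ)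

/-- Holomorphic maps between finite-dimensional spaces are smooth. -/
theorem contDiffOn_of_differentiableOn [FiniteDimensional ℂ E] [FiniteDimensional ℂ F]
    {f : E → F} {s : Set E} (hs : IsOpen s) (hf : DifferentiableOn ℂ f s) :
    ContDiffOn ℂ ∞ f s := by
  refine contDiffOn_infty.mpr fun m => ?_
  induction m generalizing f with
  | zero => exact contDiffOn_zero.mpr hf.continuousOn
  | succ m ih =>
    push_cast
    rw [contDiffOn_succ_iff_fderiv_of_isOpen hs]
    refine ⟨hf, by simp, ?_⟩
    rw [contDiffOn_clm_apply]
    exact fun e => ih fun z hz =>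
      (differentiableAt_fderiv_apply hs hf hz e).differentiableWithinAt

end SeveralComplexVariables

/-! ### Symplectic linear algebra over `ℂ` with real rotations. -/

noncomputable section SymplecticVectors

variable {n : ℕ}

theorem sympInner_eq (v w : SympVec n) :
    sympInner v w = ∑ I, (v (Sum.inl I) * w (Sum.inr I) - v (Sum.inr I) * w (Sum.inl I)) := by
  simp [sympInner, dotProduct, Matrix.fromBlocks_mulVec, Matrix.neg_mulVec,
    Finset.sum_add_distrib, sub_eq_add_neg]

/-- The symplectic group is defined through `Matrix.J`, which is `-Ω`. -/
theorem sympInner_eq_neg_J (v w : SympVec n) :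
    sympInner v w = -(v ⬝ᵥ Matrix.mulVec (Matrix.J (Fin (n + 1)) ℂ) w) := by
  rw [sympInner, ← dotProduct_neg, ← Matrix.neg_mulVec, Matrix.J, Matrix.fromBlocks_neg]
  simp

/-- The action of a real symplectic matrix as a continuous linear map. -/
def rotateL (S : Sp n) : SympVec n →L[ℂ] SympVec n :=
  LinearMap.toContinuousLinearMap (Matrix.mulVecLin
    ((S : Matrix (Fin (n + 1) ⊕ Fin (n + 1)) (Fin (n + 1) ⊕ Fin (n + 1)) ℝ).map Complex.ofReal))

@[simp]
theorem rotateL_apply (S : Sp n) (v : SympVec n) : rotateL S v = rotate S v := rfl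

theorem rotate_smul (S : Sp n) (c : ℂ) (v : SympVec n) : rotate S (c • v) = c • rotate S v :=
  (rotateL S).map_smul c v

theorem rotate_mul (S T : Sp n) (v : SympVec n) : rotate (S * T) v = rotate S (rotate T v) := by
  simp only [rotate, Matrix.mulVec_mulVec]
  congr 1
  exact Matrix.map_mul (f := Complex.ofRealHom)

/-- This is where reality of `S` matters: it makes `i⟨v̄, v⟩` invariant under rotations. -/
theorem star_rotate (S : Sp n) (v : SympVec n) : star (rotate S v) = rotate S (star v) := by
  ext I
  simp [rotate, Matrix.mulVec, dotProduct]

theorem sympInner_rotate (S : Sp n) (v w : SympVec n) :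
    sympInner (rotate S v) (rotate S w) = sympInner v w := by
  set T := (S : Matrix (Fin (n + 1) ⊕ Fin (n + 1)) (Fin (n + 1) ⊕ Fin (n + 1)) ℝ).map
    Complex.ofRealHom with hT
  have h : T.transpose * Matrix.J (Fin (n + 1)) ℂ * T = Matrix.J (Fin (n + 1)) ℂ := by
    have h1 := congrArg (fun N => N.map Complex.ofRealHom) (SymplecticGroup.mem_iff'.mp S.2)
    simpa only [Matrix.map_mul, Matrix.transpose_map, Matrix.map_J] using h1
  have hr : ∀ u, rotate S u = T.mulVec u := fun _ => rfl
  rw [sympInner_eq_neg_J, sympInner_eq_neg_J, hr, hr]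
  nth_rewrite 2 [← h]
  rw [← Matrix.mulVec_mulVec, ← Matrix.mulVec_mulVec, Matrix.dotProduct_transpose_mulVec,
    dotProduct_comm]

theorem sympInner_smul_left (c : ℂ) (v w : SympVec n) :
    sympInner (c • v) w = c * sympInner v w := by
  simp [sympInner]

theorem sympInner_smul_right (c : ℂ) (v w : SympVec n) :
    sympInner v (c • w) = c * sympInner v w := by
  simp [sympInner, Matrix.mulVec_smul]

theorem sympInner_sum_right {ι : Type*} (s : Finset ι) (v : SympVec n) (w : ι → SympVec n) :
    sympInner v (∑ i ∈ s, w i) = ∑ i ∈ s, sympInner v (w i) := by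
  simp [sympInner, Matrix.mulVec_sum, dotProduct_sum]

theorem sympInner_sum_left {ι : Type*} (s : Finset ι) (v : ι → SympVec n) (w : SympVec n) :
    sympInner (∑ i ∈ s, v i) w = ∑ i ∈ s, sympInner (v i) w := by
  simp [sympInner, sum_dotProduct]

theorem sympInner_swap (v w : SympVec n) : sympInner w v = -sympInner v w := by
  rw [sympInner_eq, sympInner_eq, ← Finset.sum_neg_distrib]
  exact Finset.sum_congr rfl fun I _ => by ring

theorem star_sympInner (v w : SympVec n) :
    (starRingEnd ℂ) (sympInner v w) = sympInner (star v) (star w) := by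
  simp [sympInner_eq]

/-- Conjugation turns `⟨v̄, v⟩` into `⟨v, v̄⟩ = -⟨v̄, v⟩`, so `i⟨v̄, v⟩` is real and taking the real
part loses nothing. -/
theorem coe_sympNorm (v : SympVec n) : (sympNorm v : ℂ) = Complex.I * sympInner (star v) v := by
  rw [sympNorm]
  refine Complex.conj_eq_iff_re.mp ?_
  rw [map_mul, star_sympInner, star_star, Complex.conj_I, sympInner_swap]
  ring

theorem sympNorm_rotate (S : Sp n) (v : SympVec n) : sympNorm (rotate S v) = sympNorm v := by
  rw [sympNorm, star_rotate, sympInner_rotate, sympNorm]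

theorem sympNorm_smul (c : ℂ) (v : SympVec n) :
    sympNorm (c • v) = Complex.normSq c * sympNorm v := by
  apply Complex.ofReal_injective
  rw [Complex.ofReal_mul, coe_sympNorm, coe_sympNorm, star_smul, sympInner_smul_left,
    sympInner_smul_right, Complex.normSq_eq_conj_mul_self, starRingEnd_apply]
  ring

open Classical in
/-- The symplectic matrix exchanging `X^I` and `Y_I` (up to sign) for `I ∉ J`. -/
def coordinateSwap (J : Set (Fin (n + 1))) : Sp n :=
  ⟨Matrix.fromBlocks (Matrix.diagonal (J.indicator 1)) (Matrix.diagonal (Jᶜ.indicator 1))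
      (-Matrix.diagonal (Jᶜ.indicator 1)) (Matrix.diagonal (J.indicator 1)), by
    rw [SymplecticGroup.fromBlocks_mem_iff]
    simp only [Matrix.diagonal_transpose, Matrix.transpose_neg, Matrix.neg_mul, Matrix.mul_neg,
      Matrix.diagonal_mul_diagonal, sub_neg_eq_add, Matrix.diagonal_add]
    refine ⟨by simp only [mul_comm], by simp only [mul_comm], ?_⟩
    rw [← Matrix.diagonal_one]
    congr 1
    ext I
    by_cases h : I ∈ J <;> simp [h]⟩

theorem rotate_coordinateSwap_inl (J : Set (Fin (n + 1))) (v : SympVec n) (I : Fin (n + 1)) :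
    rotate (coordinateSwap J) v (Sum.inl I) =
      J.indicator (fun I => v (Sum.inl I)) I + Jᶜ.indicator (fun I => v (Sum.inr I)) I := by
  classical
  rw [rotate, coordinateSwap, Matrix.fromBlocks_map, Matrix.fromBlocks_mulVec]
  by_cases h : I ∈ J <;>
    simp [h, Matrix.mulVec_diagonal, Matrix.diagonal_map]

/-- A linearly independent isotropic family of maximal length can be rotated by a real symplectic
matrix to one whose upper halves are linearly independent. -/
theorem exists_det_rotate_ne_zero (w : Fin (n + 1) → SympVec n) (hw : LinearIndependent ℂ w)
    (hiso : ∀ i j, sympInner (w i) (w j) = 0) :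
    ∃ S : Sp n, (Matrix.of fun i I => rotate S (w i) (Sum.inl I)).det ≠ 0 := by
  classical
  set A : Fin (n + 1) → Fin (n + 1) → ℂ := fun I i => w i (Sum.inl I)
  -- `J` indexes a basis of the row space of the upper half; the coordinates outside `J` are the
  -- ones to be swapped.
  obtain ⟨J, -, -, hspan, hind⟩ :=
    exists_linearIndepOn_extension (linearIndepOn_empty ℂ A) (Set.empty_subset Set.univ)
  refine ⟨coordinateSwap J, fun hdet => ?_⟩
  obtain ⟨x, hx0, hx⟩ := Matrix.exists_vecMul_eq_zero_iff.mpr hdet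
  -- A vanishing determinant yields `u` in the span whose rotated upper half is zero. The aim is `u
  -- = 0`, contradicting independence of the `w i`.
  set u : SympVec n := ∑ i, x i • w i with hu
  have hux : ∀ I, rotate (coordinateSwap J) u (Sum.inl I) = 0 := by
    intro I
    have h1 := congrFun hx I
    rw [← rotateL_apply, hu, map_sum]
    simpa [Matrix.vecMul, dotProduct] using h1
  have huJ : ∀ I ∈ J, u (Sum.inl I) = 0 := fun I hI => by
    have := hux I
    rwa [rotate_coordinateSwap_inl, Set.indicator_of_mem hI,
      Set.indicator_of_notMem (by simpa using hI), add_zero] at this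
  have huJc : ∀ I ∉ J, u (Sum.inr I) = 0 := fun I hI => by
    have := hux I
    rwa [rotate_coordinateSwap_inl, Set.indicator_of_notMem hI,
      Set.indicator_of_mem (by simpa using hI), zero_add] at this
  have hAu : ∀ I, A I ⬝ᵥ x = u (Sum.inl I) := fun I => by
    simp [A, hu, dotProduct, mul_comm]
  have hX : ∀ I, u (Sum.inl I) = 0 := by
    intro I
    rw [← hAu]
    have hI : A I ∈ Submodule.span ℂ (A '' J) := hspan ⟨I, Set.mem_univ _, rfl⟩
    generalize A I = y at hI
    induction hI using Submodule.span_induction with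
    | mem y hy =>
      obtain ⟨K, hK, rfl⟩ := hy
      rw [hAu, huJ K hK]
    | zero => simp
    | add y z _ _ hy hz => rw [add_dotProduct, hy, hz, add_zero]
    | smul c y _ hy => rw [smul_dotProduct, hy, smul_zero]
  have hY : ∀ I, u (Sum.inr I) = 0 := by
    -- The upper half of `u` is zero, so isotropy against every `w i` becomes a linear relation
    -- among the independent rows indexed by `J`.
    have hsum : ∑ I ∈ J.toFinset, u (Sum.inr I) • A I = 0 := by
      ext i
      have h1 : sympInner (w i) u = 0 := by
        simp [hu, sympInner_sum_right, sympInner_smul_right, hiso]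
      rw [sympInner_eq] at h1
      simp only [hX, mul_zero, sub_zero] at h1
      rw [Finset.sum_apply, Pi.zero_apply, ← h1]
      refine (Finset.sum_subset (Finset.subset_univ _) fun I _ hI => ?_).trans
        (Finset.sum_congr rfl fun I _ => mul_comm _ _)
      simp [huJc I (by simpa using hI)]
    intro I
    by_cases hI : I ∈ J
    · rw [← Set.coe_toFinset J, linearIndepOn_finset_iff] at hind
      exact hind _ hsum I (by simpa using hI)
    · exact huJc I hI
  have hu0 : u = 0 := by
    ext I
    rcases I with I | I
    exacts [hX I, hY I]
  exact hx0 (funext (Fintype.linearIndependent_iff.mp hw x hu0))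

end SymplecticVectors

/-! ### Product rule for the symplectic form. -/

section SympInnerCalculus

variable {n : ℕ} {𝕜 E : Type*} [NontriviallyNormedField 𝕜] [NormedAlgebra 𝕜 ℂ]
  [NormedAddCommGroup E] [NormedSpace 𝕜 E]

/-- The scalar field stays general because isotropy uses complex derivatives, while expressions
containing `v̄` are only real differentiable. -/
theorem hasFDerivAt_sympInner {f g : E → SympVec n} {f' g' : E →L[𝕜] SympVec n} {z : E}
    (hf : HasFDerivAt f f' z) (hg : HasFDerivAt g g' z) :
    ∃ L : E →L[𝕜] ℂ, HasFDerivAt (fun z => sympInner (f z) (g z)) L z ∧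
      ∀ u, L u = sympInner (f' u) (g z) + sympInner (f z) (g' u) := by
  rw [hasFDerivAt_pi'] at hf hg
  simp only [sympInner_eq]
  refine ⟨_, HasFDerivAt.fun_sum fun I _ => ((hf (Sum.inl I)).mul (hg (Sum.inr I))).sub
    ((hf (Sum.inr I)).mul (hg (Sum.inl I))), fun u => ?_⟩
  rw [← Finset.sum_add_distrib]
  simp only [sum_apply]
  refine Finset.sum_congr rfl fun I _ => ?_
  simp
  ring

theorem differentiableAt_sympInner {f g : E → SympVec n} {z : E}
    (hf : DifferentiableAt 𝕜 f z) (hg : DifferentiableAt 𝕜 g z) :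
    DifferentiableAt 𝕜 (fun z => sympInner (f z) (g z)) z :=
  let ⟨_, h, _⟩ := hasFDerivAt_sympInner hf.hasFDerivAt hg.hasFDerivAt
  h.differentiableAt

theorem fderiv_sympInner_apply {f g : E → SympVec n} {z : E}
    (hf : DifferentiableAt 𝕜 f z) (hg : DifferentiableAt 𝕜 g z) (u : E) :
    fderiv 𝕜 (fun z => sympInner (f z) (g z)) z u =
      sympInner (fderiv 𝕜 f z u) (g z) + sympInner (f z) (fderiv 𝕜 g z u) := by
  obtain ⟨L, h, hL⟩ := hasFDerivAt_sympInner hf.hasFDerivAt hg.hasFDerivAt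
  rw [h.fderiv, hL]

end SympInnerCalculus

/-! ### Isotropy of the tangent directions. -/

section Isotropy

variable {n : ℕ} {E : Type*} [NormedAddCommGroup E] [NormedSpace ℂ E] [FiniteDimensional ℂ E]

theorem fderiv_fderiv_apply_comm {F : Type*} [NormedAddCommGroup F] [NormedSpace ℂ F]
    [FiniteDimensional ℂ F] {f : E → F} {O : Set E} (hO : IsOpen O)
    (hf : DifferentiableOn ℂ f O) {z : E} (hz : z ∈ O) (a b : E) :
    fderiv ℂ (fun z => fderiv ℂ f z a) z b = fderiv ℂ (fun z => fderiv ℂ f z b) z a := by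
  have hC : ContDiffAt ℂ 2 f z :=
    (contDiffOn_infty.mp (contDiffOn_of_differentiableOn hO hf) 2).contDiffAt (hO.mem_nhds hz)
  have hd : DifferentiableAt ℂ (fderiv ℂ f) z :=
    (hC.fderiv_right (m := 1) (by norm_num)).differentiableAt (by simp)
  have hsymm : IsSymmSndFDerivAt ℂ f z := hC.isSymmSndFDerivAt (by simp)
  rw [fderiv_clm_apply hd (by fun_prop), fderiv_clm_apply hd (by fun_prop)]
  simpa using hsymm b a

/-- The tangent vectors of a horizontal map span an isotropic subspace. -/
theorem sympInner_fderiv_fderiv_eq_zero {w : E → SympVec n} {O : Set E} (hO : IsOpen O)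
    (hw : DifferentiableOn ℂ w O) {z a b : E}
    (ha : ∀ z ∈ O, sympInner (w z) (fderiv ℂ w z a) = 0)
    (hb : ∀ z ∈ O, sympInner (w z) (fderiv ℂ w z b) = 0) (hz : z ∈ O) :
    sympInner (fderiv ℂ w z a) (fderiv ℂ w z b) = 0 := by
  have hd : DifferentiableAt ℂ w z := hw.differentiableAt (hO.mem_nhds hz)
  have key : ∀ a b : E, (∀ z ∈ O, sympInner (w z) (fderiv ℂ w z b) = 0) →
      sympInner (fderiv ℂ w z a) (fderiv ℂ w z b) +
        sympInner (w z) (fderiv ℂ (fun z => fderiv ℂ w z b) z a) = 0 := by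
    intro a b hb
    rw [← fderiv_sympInner_apply hd (differentiableAt_fderiv_apply hO hw hz b)]
    have : (fun z => sympInner (w z) (fderiv ℂ w z b)) =ᶠ[nhds z] fun _ => (0 : ℂ) := by
      filter_upwards [hO.mem_nhds hz] with x hx using hb x hx
    rw [this.fderiv_eq]
    simp
  have h1 := key a b hb
  have h2 := key b a ha
  rw [fderiv_fderiv_apply_comm hO hw hz a b, sympInner_swap] at h2
  -- Exchanging `a` and `b` preserves the second-derivative term and negates `⟨∂_a w, ∂_b w⟩`, so
  -- the difference isolates the latter.
  linear_combination (1 / 2 : ℂ) * h1 - (1 / 2 : ℂ) * h2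

end Isotropy

/-! ### Wirtinger derivatives of `⟨w̄, w⟩` and of its logarithm. -/

section Wirtinger

variable {n m : ℕ}

theorem wirtinger_mul (α : Fin n) {f g : Model n → ℂ} {z : Model n}
    (hf : DifferentiableAt ℝ f z) (hg : DifferentiableAt ℝ g z) :
    wirtinger α (fun z => f z * g z) z = wirtinger α f z * g z + f z * wirtinger α g z := by
  simp only [wirtinger, fderiv_fun_mul hf hg]
  simp
  ring

theorem wirtinger_congr (α : Fin n) {f g : Model n → ℂ} {z : Model n} (h : f =ᶠ[nhds z] g) :
    wirtinger α f z = wirtinger α g z := by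
  simp only [wirtinger, h.fderiv_eq]

theorem wirtingerBar_congr (α : Fin n) {f g : Model n → ℂ} {z : Model n} (h : f =ᶠ[nhds z] g) :
    wirtingerBar α f z = wirtingerBar α g z := by
  simp only [wirtingerBar, h.fderiv_eq]

theorem differentiableAt_star {a : Model n → SympVec m} {z : Model n}
    (ha : DifferentiableAt ℝ a z) : DifferentiableAt ℝ (fun z => star (a z)) z :=
  ((starL' ℝ : SympVec m ≃L[ℝ] SympVec m).differentiableAt.comp z ha :)

/-- The first slot is antiholomorphic, so `c` comes out conjugated there. The values `c = 1` and `c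
= i` then separate the two slots in `∂_α` and `∂̄_α`. -/
theorem fderiv_sympInner_star_single {a b : Model n → SympVec m} {z : Model n}
    (ha : DifferentiableAt ℂ a z) (hb : DifferentiableAt ℂ b z) (α : Fin n) (c : ℂ) :
    fderiv ℝ (fun z => sympInner (star (a z)) (b z)) z (Pi.single α c) =
      (starRingEnd ℂ) c * sympInner (star (fderiv ℂ a z (Pi.single α 1))) (b z) +
        c * sympInner (star (a z)) (fderiv ℂ b z (Pi.single α 1)) := by
  have haR := ha.restrictScalars ℝ
  have hbR := hb.restrictScalars ℝ
  have hs : fderiv ℝ (fun z => star (a z)) z (Pi.single α c) =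
      star (fderiv ℝ a z (Pi.single α c)) := by
    have := ((starL' ℝ : SympVec m ≃L[ℝ] SympVec m).hasFDerivAt.comp z haR.hasFDerivAt).fderiv
    exact congrArg (fun L => L (Pi.single α c)) this
  have hc : (Pi.single α c : Model n) = c • Pi.single α 1 := by
    rw [← Pi.single_smul, smul_eq_mul, mul_one]
  rw [fderiv_sympInner_apply (differentiableAt_star haR) hbR, hs, ha.fderiv_restrictScalars ℝ,
    hb.fderiv_restrictScalars ℝ]
  simp only [ContinuousLinearMap.coe_restrictScalars']
  rw [hc, map_smul, map_smul, star_smul, sympInner_smul_left, sympInner_smul_right]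
  rfl

theorem wirtinger_sympInner_star {a b : Model n → SympVec m} {z : Model n}
    (ha : DifferentiableAt ℂ a z) (hb : DifferentiableAt ℂ b z) (α : Fin n) :
    wirtinger α (fun z => sympInner (star (a z)) (b z)) z =
      sympInner (star (a z)) (fderiv ℂ b z (Pi.single α 1)) := by
  simp only [wirtinger, fderiv_sympInner_star_single ha hb, map_one, Complex.conj_I]
  linear_combination (sympInner (star (fderiv ℂ a z (Pi.single α 1))) (b z) / 2 -
    sympInner (star (a z)) (fderiv ℂ b z (Pi.single α 1)) / 2) * Complex.I_mul_I

theorem wirtingerBar_sympInner_star {a b : Model n → SympVec m} {z : Model n}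
    (ha : DifferentiableAt ℂ a z) (hb : DifferentiableAt ℂ b z) (α : Fin n) :
    wirtingerBar α (fun z => sympInner (star (a z)) (b z)) z =
      sympInner (star (fderiv ℂ a z (Pi.single α 1))) (b z) := by
  simp only [wirtingerBar, fderiv_sympInner_star_single ha hb, map_one, Complex.conj_I]
  linear_combination (-sympInner (star (fderiv ℂ a z (Pi.single α 1))) (b z) / 2 +
    sympInner (star (a z)) (fderiv ℂ b z (Pi.single α 1)) / 2) * Complex.I_mul_I

theorem differentiableAt_sympInner_star {a b : Model n → SympVec m} {z : Model n}
    (ha : DifferentiableAt ℂ a z) (hb : DifferentiableAt ℂ b z) :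
    DifferentiableAt ℝ (fun z => sympInner (star (a z)) (b z)) z :=
  differentiableAt_sympInner (differentiableAt_star (ha.restrictScalars ℝ)) (hb.restrictScalars ℝ)

/-- This is `d(-log N) = -dN / N` with `N = i⟨w̄, w⟩`, where the factor `i` cancels and the
denominator is cleared. -/
theorem fderiv_neg_log_sympNorm {w : Model n → SympVec m} {z : Model n}
    (hw : DifferentiableAt ℂ w z) (hpos : 0 < sympNorm (w z)) (u : Model n) :
    fderiv ℝ (fun z => ((-Real.log (sympNorm (w z)) : ℝ) : ℂ)) z u * sympInner (star (w z)) (w z) =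
      -fderiv ℝ (fun z => sympInner (star (w z)) (w z)) z u := by
  have hH := differentiableAt_sympInner_star hw hw
  have hN : HasFDerivAt (fun z => sympNorm (w z))
      (Complex.reCLM.comp (Complex.I • fderiv ℝ (fun z => sympInner (star (w z)) (w z)) z)) z :=
    Complex.reCLM.hasFDerivAt.comp z (hH.hasFDerivAt.const_smul Complex.I)
  have hNc : HasFDerivAt (fun z => (sympNorm (w z) : ℂ))
      (Complex.I • fderiv ℝ (fun z => sympInner (star (w z)) (w z)) z) z := by
    simp only [coe_sympNorm]
    exact hH.hasFDerivAt.const_smul Complex.I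
  have h1 := (Complex.ofRealCLM.hasFDerivAt.comp z hN).unique hNc
  have h2 : HasFDerivAt (fun z => ((-Real.log (sympNorm (w z)) : ℝ) : ℂ)) _ z :=
    Complex.ofRealCLM.hasFDerivAt.comp z (hN.log hpos.ne').neg
  have h3 := congrArg (fun L => L u) h1
  have hne : (sympNorm (w z) : ℂ) ≠ 0 := by exact_mod_cast hpos.ne'
  have hH' : sympInner (star (w z)) (w z) = -Complex.I * (sympNorm (w z) : ℂ) := by
    rw [coe_sympNorm, ← mul_assoc, neg_mul, Complex.I_mul_I, neg_neg, one_mul]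
  rw [h2.fderiv, hH']
  simp only [ContinuousLinearMap.comp_apply, smul_apply, Complex.reCLM_apply,
    Complex.ofRealCLM_apply, neg_apply, smul_eq_mul] at h3 ⊢
  push_cast
  rw [h3]
  field_simp
  rw [Complex.I_sq]
  ring

theorem wirtingerBar_neg_log_sympNorm {w : Model n → SympVec m} {z : Model n}
    (hw : DifferentiableAt ℂ w z) (hpos : 0 < sympNorm (w z)) (β : Fin n) :
    wirtingerBar β (fun z => ((-Real.log (sympNorm (w z)) : ℝ) : ℂ)) z *
        sympInner (star (w z)) (w z) =
      -sympInner (star (fderiv ℂ w z (Pi.single β 1))) (w z) := by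
  rw [← wirtingerBar_sympInner_star hw hw, wirtingerBar, wirtingerBar]
  linear_combination (1 / 2 : ℂ) * fderiv_neg_log_sympNorm hw hpos (Pi.single β 1) +
    (1 / 2 : ℂ) * Complex.I * fderiv_neg_log_sympNorm hw hpos (Pi.single β Complex.I)

/-- The metric with potential `-log (i⟨w̄, w⟩)`. -/
theorem wirtinger_wirtingerBar_neg_log_sympNorm {w : Model n → SympVec m} {O : Set (Model n)}
    (hO : IsOpen O) (hw : DifferentiableOn ℂ w O) (hpos : ∀ z ∈ O, 0 < sympNorm (w z))
    {z : Model n} (hz : z ∈ O) (α β : Fin n) :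
    wirtinger α (wirtingerBar β fun z => ((-Real.log (sympNorm (w z)) : ℝ) : ℂ)) z *
        sympInner (star (w z)) (w z) ^ 2 =
      -sympInner (star (fderiv ℂ w z (Pi.single β 1))) (fderiv ℂ w z (Pi.single α 1)) *
          sympInner (star (w z)) (w z) +
        sympInner (star (fderiv ℂ w z (Pi.single β 1))) (w z) *
          sympInner (star (w z)) (fderiv ℂ w z (Pi.single α 1)) := by
  have hd : ∀ x ∈ O, DifferentiableAt ℂ w x := fun x hx => hw.differentiableAt (hO.mem_nhds hx)
  have hne : ∀ x ∈ O, sympInner (star (w x)) (w x) ≠ 0 := by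
    intro x hx h0
    have := coe_sympNorm (w x)
    rw [h0, mul_zero, Complex.ofReal_eq_zero] at this
    exact (hpos x hx).ne' this
  have hH := differentiableAt_sympInner_star (hd z hz) (hd z hz)
  have hdβ := differentiableAt_fderiv_apply hO hw hz (Pi.single β 1)
  have hQ := differentiableAt_sympInner_star hdβ (hd z hz)
  -- The quotient form serves only to show that `∂̄_β K` is differentiable.
  have hPQ : (wirtingerBar β fun z => ((-Real.log (sympNorm (w z)) : ℝ) : ℂ)) =ᶠ[nhds z]
      fun z => -sympInner (star (fderiv ℂ w z (Pi.single β 1))) (w z) *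
        (sympInner (star (w z)) (w z))⁻¹ := by
    filter_upwards [hO.mem_nhds hz] with x hx
    rw [← wirtingerBar_neg_log_sympNorm (hd x hx) (hpos x hx) β, mul_inv_cancel_right₀ (hne x hx)]
  have hP : DifferentiableAt ℝ
      (wirtingerBar β fun z => ((-Real.log (sympNorm (w z)) : ℝ) : ℂ)) z :=
    (hQ.neg.mul (hH.inv (hne z hz))).congr_of_eventuallyEq hPQ
  -- The first-order identity holds near `z`, so `∂_α` can be applied to it in product form.
  have hPN : (fun x => wirtingerBar β (fun z => ((-Real.log (sympNorm (w z)) : ℝ) : ℂ)) x *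
      sympInner (star (w x)) (w x)) =ᶠ[nhds z]
      fun z => (-1 : ℂ) * sympInner (star (fderiv ℂ w z (Pi.single β 1))) (w z) := by
    filter_upwards [hO.mem_nhds hz] with x hx
    rw [wirtingerBar_neg_log_sympNorm (hd x hx) (hpos x hx) β, neg_one_mul]
  have h1 := wirtinger_congr α hPN
  rw [wirtinger_mul α hP hH, wirtinger_mul α (by fun_prop) hQ,
    wirtinger_sympInner_star (hd z hz) (hd z hz), wirtinger_sympInner_star hdβ (hd z hz)] at h1
  have h0 : wirtinger α (fun _ : Model n => (-1 : ℂ)) z = 0 := by simp [wirtinger]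
  have h2 := wirtingerBar_neg_log_sympNorm (hd z hz) (hpos z hz) β
  rw [h0] at h1
  linear_combination sympInner (star (w z)) (w z) * h1 -
    sympInner (star (w z)) (fderiv ℂ w z (Pi.single α 1)) * h2

end Wirtinger

/-! ### Homogeneous prepotentials and Euler's relations. -/

section Homogeneous

variable {n : ℕ} {D : Set (Fin (n + 1) → ℂ)} {F : (Fin (n + 1) → ℂ) → ℂ}

theorem fderiv_apply_eq_sum_partialF (Z u : Fin (n + 1) → ℂ) :
    fderiv ℂ F Z u = ∑ I, u I * partialF F I Z := by
  conv_lhs => rw [pi_eq_sum_univ' u, map_sum]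
  simp [partialF]

namespace IsHomogeneousPrepotential

variable (h : IsHomogeneousPrepotential D F)
include h

theorem differentiableOn_partialF (I : Fin (n + 1)) : DifferentiableOn ℂ (partialF F I) D :=
  fun _ hZ => (differentiableAt_fderiv_apply h.isOpen h.holomorphic hZ _).differentiableWithinAt

theorem differentiableOn_prepotentialVec : DifferentiableOn ℂ (prepotentialVec F) D := by
  rw [differentiableOn_pi]
  rintro (I | I)
  · exact (differentiable_apply (𝕜 := ℂ) I).differentiableOn
  · exact h.differentiableOn_partialF I

theorem differentiableAt {Z : Fin (n + 1) → ℂ} (hZ : Z ∈ D) : DifferentiableAt ℂ F Z :=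
  h.holomorphic.differentiableAt (h.isOpen.mem_nhds hZ)

theorem fderiv_smul {Z : Fin (n + 1) → ℂ} (hZ : Z ∈ D) {c : ℂ} (hc : c ≠ 0)
    (u : Fin (n + 1) → ℂ) : fderiv ℂ F (c • Z) u = c * fderiv ℂ F Z u := by
  have h1 : (fun Y => F (c • Y)) =ᶠ[nhds Z] fun Y => c ^ 2 * F Y := by
    filter_upwards [h.isOpen.mem_nhds hZ] with Y hY using h.homogeneous Y hY c hc
  have h2 : HasFDerivAt (fun Y => F (c • Y))
      ((fderiv ℂ F (c • Z)).comp (c • ContinuousLinearMap.id ℂ _)) Z :=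
    (h.differentiableAt (h.cone Z hZ c hc)).hasFDerivAt.comp Z ((hasFDerivAt_id Z).const_smul c)
  have h3 := (h2.congr_of_eventuallyEq h1.symm).unique
    ((h.differentiableAt hZ).hasFDerivAt.const_mul (c ^ 2))
  have h4 := congrArg (fun L => L u) h3
  simp only [ContinuousLinearMap.comp_apply, smul_apply,
    ContinuousLinearMap.id_apply, map_smul, smul_eq_mul] at h4
  exact mul_left_cancel₀ hc (h4.trans (by ring))

/-- Euler's relation for `∂F`, which is homogeneous of degree one. -/
theorem fderiv_fderiv_self {Z : Fin (n + 1) → ℂ} (hZ : Z ∈ D) (u : Fin (n + 1) → ℂ) :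
    fderiv ℂ (fun Y => fderiv ℂ F Y u) Z Z = fderiv ℂ F Z u := by
  have hd := differentiableAt_fderiv_apply h.isOpen h.holomorphic hZ u
  have h1 : HasDerivAt (fun c : ℂ => c • Z) Z 1 := by
    simpa using (hasDerivAt_id (1 : ℂ)).smul_const Z
  have h2 : HasDerivAt (fun c : ℂ => fderiv ℂ F (c • Z) u)
      (fderiv ℂ (fun Y => fderiv ℂ F Y u) Z Z) 1 := by
    have h0 : HasFDerivAt (fun Y => fderiv ℂ F Y u) (fderiv ℂ (fun Y => fderiv ℂ F Y u) Z)
      ((1 : ℂ) • Z) := by simpa using hd.hasFDerivAt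
    exact h0.comp_hasDerivAt (1 : ℂ) h1
  have h3 : (fun c : ℂ => fderiv ℂ F (c • Z) u) =ᶠ[nhds 1] fun c => c * fderiv ℂ F Z u := by
    filter_upwards [isOpen_ne.mem_nhds one_ne_zero] with c hc using h.fderiv_smul hZ hc u
  have h4 : HasDerivAt (fun c : ℂ => c * fderiv ℂ F Z u) (fderiv ℂ F Z u) 1 := by
    simpa using (hasDerivAt_id (1 : ℂ)).mul_const (fderiv ℂ F Z u)
  exact (h2.congr_of_eventuallyEq h3.symm).unique h4

/-- The pairing is `Z^I ∂_u F_I - u^I F_I`. By symmetry of second derivatives the first term is the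
derivative of `∂_u F` along `Z`, which Euler's relation equates with `∂_u F = u^I F_I`. -/
theorem sympInner_fderiv_prepotentialVec {Z : Fin (n + 1) → ℂ} (hZ : Z ∈ D)
    (u : Fin (n + 1) → ℂ) :
    sympInner (prepotentialVec F Z) (fderiv ℂ (prepotentialVec F) Z u) = 0 := by
  have hd := h.differentiableOn_prepotentialVec.differentiableAt (h.isOpen.mem_nhds hZ)
  have hcomp : ∀ A, fderiv ℂ (prepotentialVec F) Z u A =
      fderiv ℂ (fun Y => prepotentialVec F Y A) Z u := fun A => by
    rw [fderiv_pi fun A => differentiableAt_pi.mp hd A]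
    rfl
  have hl : ∀ I, fderiv ℂ (fun Y => prepotentialVec F Y (Sum.inl I)) Z u = u I := fun I =>
    congrArg (fun L => L u) (ContinuousLinearMap.proj (R := ℂ) I : (Fin (n + 1) → ℂ) →L[ℂ] ℂ).fderiv
  have hr : ∀ I, fderiv ℂ (fun Y => prepotentialVec F Y (Sum.inr I)) Z u =
      fderiv ℂ (fun Y => fderiv ℂ F Y u) Z (Pi.single I 1) := fun I =>
    fderiv_fderiv_apply_comm h.isOpen h.holomorphic hZ _ _
  have hsum : ∑ I, Z I * fderiv ℂ (fun Y => fderiv ℂ F Y u) Z (Pi.single I 1) =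
      ∑ I, u I * partialF F I Z := by
    rw [← fderiv_apply_eq_sum_partialF, ← h.fderiv_fderiv_self hZ u]
    exact (fderiv_apply_eq_sum_partialF (F := fun Y => fderiv ℂ F Y u) Z Z).symm
  rw [sympInner_eq, Finset.sum_sub_distrib]
  simp only [hcomp, hl, hr]
  simp only [prepotentialVec, Sum.elim_inl, Sum.elim_inr, hsum]
  rw [sub_eq_zero]
  exact Finset.sum_congr rfl fun I _ => mul_comm _ _

end IsHomogeneousPrepotential

theorem sympNorm_prepotentialVec (F : (Fin (n + 1) → ℂ) → ℂ) (Z : Fin (n + 1) → ℂ) :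
    sympNorm (prepotentialVec F Z) = prepotentialNorm F Z := by
  rw [sympNorm, prepotentialNorm, sympInner_eq, Finset.sum_sub_distrib, mul_sub]
  simp only [prepotentialVec, Pi.star_apply, Sum.elim_inl, Sum.elim_inr, starRingEnd_apply]
  simp only [mul_comm (star (partialF F _ Z))]

end Homogeneous

/-! ### From prepotential models to symplectic models. -/

section Manifolds

variable {n : ℕ} {M : Type u} [TopologicalSpace M] [ChartedSpace (Model n) M]

theorem HolomorphicOn.comp_symm {V : Type*} [NormedAddCommGroup V] [NormedSpace ℂ V] {f : M → V}
    {U : Set M} (hf : HolomorphicOn (n := n) f U) {e : OpenPartialHomeomorph M (Model n)}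
    (he : IsHolomorphicChart e) :
    DifferentiableOn ℂ (f ∘ e.symm) (e.target ∩ e.symm ⁻¹' U) := by
  rw [← mdifferentiableOn_iff_differentiableOn]
  exact hf.comp (((contMDiffOn_symm_of_mem_maximalAtlas he).mdifferentiableOn (by simp)).mono
    Set.inter_subset_left) fun _ h => h.2

theorem HolomorphicOn.postcomp {V W : Type*} [NormedAddCommGroup V] [NormedSpace ℂ V]
    [NormedAddCommGroup W] [NormedSpace ℂ W] {f : M → V} {U : Set M} {G : V → W} {D : Set V}
    (hG : DifferentiableOn ℂ G D) (hf : HolomorphicOn (n := n) f U) (hfD : Set.MapsTo f U D) :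
    HolomorphicOn (n := n) (fun x => G (f x)) U :=
  (mdifferentiableOn_iff_differentiableOn.mpr hG).comp hf hfD

theorem KahlerMetric.IsPotential.mono_congr {g : KahlerMetric n M} {U V : Set M} {K L : M → ℝ}
    (h : g.IsPotential U K) (hV : IsOpen V) (hVU : V ⊆ U) (hKL : ∀ x ∈ V, L x = K x) :
    g.IsPotential V L := by
  intro e he
  refine ⟨((h e he).1.mono fun z hz => ⟨hz.1, hVU hz.2⟩).congr fun z hz => hKL _ hz.2,
    fun z hz α β => ?_⟩
  rw [(h e he).2 z ⟨hz.1, hVU hz.2⟩]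
  refine wirtinger_congr α ?_
  have hev : (fun w => (K (e.symm w) : ℂ)) =ᶠ[nhds z] fun w => (L (e.symm w) : ℂ) := by
    filter_upwards [(e.isOpen_inter_preimage_symm hV).mem_nhds hz] with w hw
    rw [hKL _ hw.2]
  exact hev.eventuallyEq_nhds.mono fun w hw => wirtingerBar_congr β hw

theorem IsPrepotentialChart.isSymplecticSection {g : KahlerMetric n M}
    {c : OpenPartialHomeomorph M (Model n)} {Z : M → Fin (n + 1) → ℂ} {D : Set (Fin (n + 1) → ℂ)}
    {F : (Fin (n + 1) → ℂ) → ℂ} (h : IsPrepotentialChart g c Z D F) :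
    IsSymplecticSection g c.source fun x => prepotentialVec F (Z x) where
  holomorphic := h.coordinates.holomorphic.postcomp
    h.prepotential.differentiableOn_prepotentialVec h.mapsTo
  norm_pos x hx := by
    rw [sympNorm_prepotentialVec]
    exact h.norm_pos x hx
  potential := by
    simp only [sympNorm_prepotentialVec]
    exact h.potential
  inner_deriv e he x hx α := by
    have hz : e x ∈ e.target ∩ e.symm ⁻¹' c.source :=
      ⟨e.map_source hx.1, by rw [Set.mem_preimage, e.left_inv hx.1]; exact hx.2⟩
    have hd : DifferentiableAt ℂ (Z ∘ e.symm) (e x) :=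
      (h.coordinates.holomorphic.comp_symm he).differentiableAt
        ((e.isOpen_inter_preimage_symm c.open_source).mem_nhds hz)
    have hZx : (Z ∘ e.symm) (e x) = Z x := by simp [e.left_inv hx.1]
    have hd' : DifferentiableAt ℂ (prepotentialVec F) ((Z ∘ e.symm) (e x)) := by
      rw [hZx]
      exact h.prepotential.differentiableOn_prepotentialVec.differentiableAt
        (h.prepotential.isOpen.mem_nhds (h.mapsTo x hx.2))
    rw [coordDeriv]
    have : ((fun x => prepotentialVec F (Z x)) ∘ e.symm) = prepotentialVec F ∘ (Z ∘ e.symm) := rfl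
    rw [this, fderiv_comp _ hd' hd, hZx]
    exact h.prepotential.sympInner_fderiv_prepotentialVec (h.mapsTo x hx.2) _

/-- Rotations preserve the norm and `|e^f|² = e^{2 Re f}`, so gluing alone implies the Kähler
transformation. -/
theorem SymplecticBundle.Glues.neg_log_sympNorm {ι : Type u} {U : ι → Set M}
    {B : SymplecticBundle (n := n) U} {v : ι → M → SympVec n} (h : B.Glues v) {i j : ι} {x : M}
    (hx : x ∈ U i ∩ U j) (hpos : 0 < sympNorm (v j x)) :
    -Real.log (sympNorm (v i x)) = -Real.log (sympNorm (v j x)) - 2 * (B.f i j x).re := by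
  rw [h i j x hx, sympNorm_smul, sympNorm_rotate, Complex.normSq_eq_norm_sq, Complex.norm_exp,
    Real.log_mul (by positivity) hpos.ne', Real.log_pow, Real.log_exp]
  push_cast
  ring

/-- The symplectic model with the vectors `(Z, ∂F)` of a prepotential model. -/
noncomputable def PrepotentialModel.toSymplecticModel {g : KahlerMetric n M} (P : PrepotentialModel g) :
    SymplecticModel g where
  ι := P.ι
  U i := (P.chart i).source
  isOpen i := (P.chart i).open_source
  cover := P.cover
  bundle := P.bundle
  v i x := prepotentialVec (P.F i) (P.Z i x)
  glues := P.glues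
  isSection i := (P.isPrepotential i).isSymplecticSection
  kahler_transf _ j _ hx := P.glues.neg_log_sympNorm hx
    ((P.isPrepotential j).isSymplecticSection.norm_pos _ hx.2)

end Manifolds

/-! ### Local construction of the prepotential. -/

noncomputable section LocalPrepotential

variable {n : ℕ}

/-- Euler's relation for a homogeneous prepotential. -/
theorem IsHomogeneousPrepotential.fderiv_self {D : Set (Fin (n + 1) → ℂ)}
    {F : (Fin (n + 1) → ℂ) → ℂ} (h : IsHomogeneousPrepotential D F) {Z : Fin (n + 1) → ℂ}
    (hZ : Z ∈ D) : fderiv ℂ F Z Z = 2 * F Z := by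
  have h1 : HasDerivAt (fun c : ℂ => c • Z) Z 1 := by
    simpa using (hasDerivAt_id (1 : ℂ)).smul_const Z
  have h2 : HasDerivAt (fun c : ℂ => F (c • Z)) (fderiv ℂ F Z Z) 1 := by
    have h0 : HasFDerivAt F (fderiv ℂ F Z) ((1 : ℂ) • Z) := by
      simpa using (h.differentiableAt hZ).hasFDerivAt
    exact h0.comp_hasDerivAt (1 : ℂ) h1
  have h3 : (fun c : ℂ => F (c • Z)) =ᶠ[nhds 1] fun c => c ^ 2 * F Z := by
    filter_upwards [isOpen_ne.mem_nhds one_ne_zero] with c hc using h.homogeneous Z hZ c hc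
  have h4 : HasDerivAt (fun c : ℂ => c ^ 2 * F Z) (2 * F Z) 1 := by
    simpa using (hasDerivAt_pow 2 (1 : ℂ)).mul_const (F Z)
  exact (h2.congr_of_eventuallyEq h3.symm).unique h4

/-- The matrix with rows `X` and `∂_α X`. -/
def frameMatrix (X : Model n → Fin (n + 1) → ℂ) (z : Model n) :
    Matrix (Fin (n + 1)) (Fin (n + 1)) ℂ :=
  Matrix.of (Fin.cons (X z) fun α => fderiv ℂ X z (Pi.single α 1))

/-- The affine coordinates of a point in the projective space of `ℂ^(n+1)`. -/
def affineCoord (Y : Fin (n + 1) → ℂ) : Model n := fun α => Y α.succ / Y 0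

theorem affineCoord_smul {c : ℂ} (hc : c ≠ 0) (Y : Fin (n + 1) → ℂ) :
    affineCoord (c • Y) = affineCoord Y := by
  ext α
  simp [affineCoord, mul_div_mul_left _ _ hc]

theorem isOpen_apply_zero_ne_zero : IsOpen {Y : Fin (n + 1) → ℂ | Y 0 ≠ 0} :=
  isOpen_ne.preimage (continuous_apply 0)

theorem differentiableOn_affineCoord :
    DifferentiableOn ℂ (affineCoord (n := n)) {Y | Y 0 ≠ 0} := by
  rw [differentiableOn_pi]
  have h (I : Fin (n + 1)) : DifferentiableOn ℂ (fun Y : Fin (n + 1) → ℂ => Y I) {Y | Y 0 ≠ 0} :=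
    (differentiable_apply (𝕜 := ℂ) I).differentiableOn
  exact fun α => (h α.succ).mul ((h 0).inv fun Y hY => hY)

/-- In this normalised frame the numerators `X^{α+1}` vanish at `z` and `X^0 = 1`, so the derivative
of the denominator drops out. -/
theorem hasFDerivAt_affineCoord {X : Model n → Fin (n + 1) → ℂ} {z : Model n}
    {X' : Model n →L[ℂ] Fin (n + 1) → ℂ} (hX : HasFDerivAt X X' z)
    (h0 : X z = Pi.single 0 1) (h' : ∀ α : Fin n, X' (Pi.single α 1) = Pi.single α.succ 1) :
    HasFDerivAt (fun z => affineCoord (X z)) (ContinuousLinearMap.id ℂ (Model n)) z := by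
  have hc : ∀ u : Model n, X' u = ∑ β, u β • (Pi.single β.succ 1 : Fin (n + 1) → ℂ) := fun u => by
    conv_lhs => rw [pi_eq_sum_univ' u, map_sum]
    simp [h']
  rw [hasFDerivAt_pi'] at hX ⊢
  intro α
  have hne : X z 0 ≠ 0 := by simp [h0]
  refine ((hX α.succ).mul ((hasDerivAt_inv hne).comp_hasFDerivAt z (hX 0))).congr_fderiv ?_
  ext u
  simp [h0, hc u, Pi.single_apply]

/-- A map whose values and derivatives span `ℂ^(n+1)` gives local projective coordinates. -/
theorem exists_openPartialHomeomorph_affineCoord {X : Model n → Fin (n + 1) → ℂ}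
    {O : Set (Model n)} (hO : IsOpen O) (hX : DifferentiableOn ℂ X O) {z₀ : Model n} (hz₀ : z₀ ∈ O)
    (hdet : (frameMatrix X z₀).det ≠ 0) :
    ∃ (ℓ : (Fin (n + 1) → ℂ) →L[ℂ] Fin (n + 1) → ℂ) (T : OpenPartialHomeomorph (Model n) (Model n)),
      z₀ ∈ T.source ∧ T.source ⊆ O ∧
      (∀ z ∈ T.source, ℓ (X z) 0 ≠ 0 ∧ (frameMatrix X z).det ≠ 0 ∧ T z = affineCoord (ℓ (X z))) ∧
      DifferentiableOn ℂ T.symm T.target := by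
  set B := frameMatrix X z₀ with hB
  -- Multiplication by `B⁻¹` sends `X` and `∂_α X` at `z₀` to the standard basis; `X^0` itself may
  -- vanish there.
  set ℓ : (Fin (n + 1) → ℂ) →L[ℂ] Fin (n + 1) → ℂ :=
    LinearMap.toContinuousLinearMap (Matrix.vecMulLinear B⁻¹) with hℓ
  have hℓB : ∀ i, ℓ (B i) = Pi.single i 1 := by
    intro i
    have h1 : B i = Matrix.vecMul (Pi.single i 1) B := (Matrix.single_one_vecMul i B).symm
    have h2 : ∀ Y, ℓ Y = Matrix.vecMul Y B⁻¹ := fun _ => rfl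
    rw [h2, h1, Matrix.vecMul_vecMul, Matrix.mul_nonsing_inv _ (isUnit_iff_ne_zero.mpr hdet),
      Matrix.vecMul_one]
  have hXz : HasFDerivAt X (fderiv ℂ X z₀) z₀ :=
    (hX.differentiableAt (hO.mem_nhds hz₀)).hasFDerivAt
  have hX0 : ℓ (X z₀) = Pi.single 0 1 := hℓB 0
  set t : Model n → Model n := fun z => affineCoord (ℓ (X z)) with ht
  have ht' : HasFDerivAt t (ContinuousLinearEquiv.refl ℂ (Model n) : Model n →L[ℂ] Model n) z₀ :=
    hasFDerivAt_affineCoord (ℓ.hasFDerivAt.comp z₀ hXz) hX0 fun α => hℓB α.succ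
  have hdX : ContinuousOn (fun z => (frameMatrix X z).det) O := by
    have h1 : ∀ α : Fin n, ContinuousOn (fun z => fderiv ℂ X z (Pi.single α 1)) O := fun α z hz =>
      (differentiableAt_fderiv_apply hO hX hz _).continuousAt.continuousWithinAt
    have h2 : ContinuousOn (frameMatrix X) O := by
      refine continuousOn_pi.mpr fun i => ?_
      refine Fin.cases hX.continuousOn (fun α => h1 α) i
    exact (Continuous.matrix_det continuous_id).comp_continuousOn h2
  have hℓX : ContinuousOn (fun z => ℓ (X z) 0) O :=
    (continuous_apply 0).comp_continuousOn (ℓ.continuous.comp_continuousOn hX.continuousOn)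
  set O₁ := (O ∩ (fun z => (frameMatrix X z).det) ⁻¹' {0}ᶜ) ∩ (O ∩ (fun z => ℓ (X z) 0) ⁻¹' {0}ᶜ)
  have hO₁ : IsOpen O₁ := (hdX.isOpen_inter_preimage hO isOpen_compl_singleton).inter
    (hℓX.isOpen_inter_preimage hO isOpen_compl_singleton)
  have htd : DifferentiableOn ℂ t O₁ :=
    differentiableOn_affineCoord.comp
      (ℓ.differentiable.comp_differentiableOn (hX.mono fun z hz => hz.1.1)) fun z hz => hz.2.2
  have htC := contDiffOn_of_differentiableOn hO₁ htd
  have hz₁ : z₀ ∈ O₁ := ⟨⟨hz₀, hdet⟩, hz₀, by simp [hX0]⟩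
  -- Keeping the derivative invertible throughout makes the inverse holomorphic on the whole target,
  -- not just at the image of `z₀`.
  set O₂ := O₁ ∩ fderiv ℂ t ⁻¹' (Set.range ((↑) : (Model n ≃L[ℂ] Model n) → Model n →L[ℂ] Model n))
  have hO₂ : IsOpen O₂ := (htC.continuousOn_fderiv_of_isOpen hO₁ (by simp)).isOpen_inter_preimage
    hO₁ ContinuousLinearEquiv.isOpen
  have hz₂ : z₀ ∈ O₂ := ⟨hz₁, ⟨ContinuousLinearEquiv.refl ℂ _, ht'.fderiv.symm⟩⟩
  have htC₀ : ContDiffAt ℂ ∞ t z₀ := htC.contDiffAt (hO₁.mem_nhds hz₁)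
  set T₀ := htC₀.toOpenPartialHomeomorph t ht' (by simp)
  set T := T₀.restrOpen O₂ hO₂ with hT
  refine ⟨ℓ, T, ⟨htC₀.mem_toOpenPartialHomeomorph_source ht' (by simp), hz₂⟩,
    fun z hz => hz.2.1.1.1, fun z hz => ⟨hz.2.1.2.2, hz.2.1.1.2, rfl⟩, fun y hy => ?_⟩
  obtain ⟨-, f', hf'⟩ := (T.map_target hy).2
  have hd : HasFDerivAt T (f' : Model n →L[ℂ] Model n) (T.symm y) := by
    rw [hf']
    exact (htd.differentiableAt (hO₁.mem_nhds (T.map_target hy).2.1)).hasFDerivAt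
  exact (T.hasFDerivAt_symm hy hd).differentiableAt.differentiableWithinAt

/-- A horizontal map whose upper half gives projective coordinates comes from a prepotential. -/
theorem exists_prepotential {w : Model n → SympVec n} {O : Set (Model n)} (hO : IsOpen O)
    (hw : DifferentiableOn ℂ w O)
    (hhor : ∀ z ∈ O, ∀ α, sympInner (w z) (fderiv ℂ w z (Pi.single α 1)) = 0)
    {z₀ : Model n} (hz₀ : z₀ ∈ O)
    (hdet : (frameMatrix (fun z I => w z (Sum.inl I)) z₀).det ≠ 0) :
    ∃ (N : Set (Model n)) (D : Set (Fin (n + 1) → ℂ)) (F : (Fin (n + 1) → ℂ) → ℂ),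
      IsOpen N ∧ z₀ ∈ N ∧ N ⊆ O ∧ IsHomogeneousPrepotential D F ∧
      (∀ z ∈ N, (fun I => w z (Sum.inl I)) ∈ D ∧
        (frameMatrix (fun z I => w z (Sum.inl I)) z).det ≠ 0 ∧
        w z = prepotentialVec F fun I => w z (Sum.inl I)) ∧
      ∀ x ∈ N, ∀ y ∈ N, ∀ c : ℂ,
        (fun I => w x (Sum.inl I)) = c • (fun I => w y (Sum.inl I)) → x = y := by
  set X : Model n → Fin (n + 1) → ℂ := fun z I => w z (Sum.inl I) with hXdef
  have hwI := differentiableOn_pi.mp hw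
  have hX : DifferentiableOn ℂ X O := differentiableOn_pi.mpr fun I => hwI (Sum.inl I)
  obtain ⟨ℓ, T, hz₀T, hTO, hT, hTsymm⟩ :=
    exists_openPartialHomeomorph_affineCoord hO hX hz₀ hdet
  -- Euler's relation `2F = X^I F_I` forces this value of `F` at `X z`; dividing by the square of a
  -- linear form gives the degree-zero function from which `F` is built.
  set h : Model n → ℂ := fun z => (1 / 2 : ℂ) * ∑ I, w z (Sum.inl I) * w z (Sum.inr I) with hh
  set H : Model n → ℂ := fun z => h z / ℓ (X z) 0 ^ 2 with hH
  set D : Set (Fin (n + 1) → ℂ) :=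
    {Y | ℓ Y 0 ≠ 0} ∩ (fun Y => affineCoord (ℓ Y)) ⁻¹' T.target with hD
  set F : (Fin (n + 1) → ℂ) → ℂ := fun Y => ℓ Y 0 ^ 2 * H (T.symm (affineCoord (ℓ Y))) with hF
  have hℓ0 : IsOpen {Y | ℓ Y 0 ≠ 0} := isOpen_apply_zero_ne_zero.preimage ℓ.continuous
  have hτ : DifferentiableOn ℂ (fun Y => affineCoord (ℓ Y)) {Y | ℓ Y 0 ≠ 0} :=
    differentiableOn_affineCoord.comp ℓ.differentiable.differentiableOn fun _ hY => hY
  have hhd : DifferentiableOn ℂ h O :=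
    (DifferentiableOn.fun_sum fun I _ => (hwI (Sum.inl I)).mul (hwI (Sum.inr I))).const_mul _
  have hHd : DifferentiableOn ℂ H T.source := by
    refine (hhd.mono hTO).mul (DifferentiableOn.inv (DifferentiableOn.pow ?_ 2) fun z hz =>
      pow_ne_zero 2 (hT z hz).1)
    exact (differentiable_apply (𝕜 := ℂ) (0 : Fin (n + 1))).comp_differentiableOn
      (ℓ.differentiable.comp_differentiableOn (hX.mono hTO))
  have hFhom : IsHomogeneousPrepotential D F :=
    { isOpen := hτ.continuousOn.isOpen_inter_preimage hℓ0 T.open_target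
      cone := fun Y hY c hc => by
        refine ⟨?_, ?_⟩
        · simpa [hc] using hY.1
        · rw [Set.mem_preimage, map_smul, affineCoord_smul hc]
          exact hY.2
      holomorphic := by
        refine DifferentiableOn.mul ?_ (hHd.comp (hTsymm.comp (hτ.mono Set.inter_subset_left)
          fun _ hY => hY.2) fun _ hY => T.map_target hY.2)
        exact (((differentiable_apply (𝕜 := ℂ) (0 : Fin (n + 1))).comp
          ℓ.differentiable).pow 2).differentiableOn
      homogeneous := fun Y hY c hc => by
        simp only [hF, map_smul, affineCoord_smul hc, Pi.smul_apply, smul_eq_mul]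
        ring }
  have hXD : ∀ z ∈ T.source, X z ∈ D := fun z hz => by
    refine ⟨(hT z hz).1, ?_⟩
    rw [Set.mem_preimage, ← (hT z hz).2.2]
    exact T.map_source hz
  have hFX : ∀ z ∈ T.source, F (X z) = h z := fun z hz => by
    simp only [hF, ← (hT z hz).2.2, T.left_inv hz, hH]
    rw [mul_div_cancel₀ _ (pow_ne_zero 2 (hT z hz).1)]
  refine ⟨T.source, D, F, T.open_source, hz₀T, hTO, hFhom,
    fun z hz => ⟨hXD z hz, (hT z hz).2.1, ?_⟩, fun x hx y hy c hxy => ?_⟩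
  · have hzO := hO.mem_nhds (hTO hz)
    have hXz := (hX.differentiableAt hzO).hasFDerivAt
    have hwz := hw.differentiableAt hzO
    have hFz := hFhom.differentiableAt (hXD z hz)
    set q : Fin (n + 1) → ℂ := fun I => partialF F I (X z) - w z (Sum.inr I) with hq
    have hw' : ∀ u A, fderiv ℂ w z u A = fderiv ℂ (fun z => w z A) z u := fun u A => by
      rw [fderiv_pi fun A => differentiableAt_pi.mp hwz A]
      rfl
    have hX' : ∀ u I, fderiv ℂ X z u I = fderiv ℂ w z u (Sum.inl I) := fun u I => by
      rw [hw', fderiv_pi fun I => differentiableAt_pi.mp hwz (Sum.inl I)]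
      rfl
    -- The row `X` is Euler's relation. The rows `∂_α X` come from differentiating `F ∘ X = h` and
    -- using horizontality.
    have hq0 : (frameMatrix X z).mulVec q = 0 := by
      ext i
      refine Fin.cases ?_ (fun α => ?_) i
      · have h1 := hFhom.fderiv_self (hXD z hz)
        rw [fderiv_apply_eq_sum_partialF, hFX z hz, hh] at h1
        simp only [frameMatrix, Matrix.mulVec, dotProduct, Matrix.of_apply, Fin.cons_zero, hq,
          mul_sub, Finset.sum_sub_distrib, h1, Pi.zero_apply]
        simp only [hXdef]
        ring
      · have h1 : (fun z => F (X z)) =ᶠ[nhds z] h := by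
          filter_upwards [T.open_source.mem_nhds hz] with x hx using hFX x hx
        have h2 := congrArg (fun L => L (Pi.single α 1))
          ((hFz.hasFDerivAt.comp z hXz).fderiv.symm.trans h1.fderiv_eq)
        have h3 : fderiv ℂ h z (Pi.single α 1) = (1 / 2 : ℂ) * ∑ I,
            (w z (Sum.inl I) * fderiv ℂ w z (Pi.single α 1) (Sum.inr I) +
              w z (Sum.inr I) * fderiv ℂ w z (Pi.single α 1) (Sum.inl I)) := by
          have hwA := fun A => (differentiableAt_pi.mp hwz A).hasFDerivAt
          have : HasFDerivAt h _ z := (HasFDerivAt.fun_sum fun I (_ : I ∈ Finset.univ) =>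
            (hwA (Sum.inl I)).mul (hwA (Sum.inr I))).const_mul (1 / 2 : ℂ)
          rw [this.fderiv]
          simp [hw', sum_apply]
        have h4 := hhor z (hTO hz) α
        rw [sympInner_eq, Finset.sum_sub_distrib] at h4
        simp only [ContinuousLinearMap.comp_apply, h3, Finset.sum_add_distrib,
          fderiv_apply_eq_sum_partialF, hX'] at h2
        simp only [frameMatrix, Matrix.mulVec, dotProduct, Matrix.of_apply, Fin.cons_succ, hq,
          mul_sub, Finset.sum_sub_distrib, Pi.zero_apply, hX', h2]
        simp only [mul_comm (fderiv ℂ w z _ _)]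
        linear_combination (1 / 2 : ℂ) * h4
    have hq1 := Matrix.eq_zero_of_mulVec_eq_zero (hT z hz).2.1 hq0
    ext A
    rcases A with I | I
    · rfl
    · exact (sub_eq_zero.mp (congrFun hq1 I)).symm
  · change X x = c • X y at hxy
    refine T.injOn hx hy ?_
    have hc : c ≠ 0 := by
      rintro rfl
      refine (hT x hx).1 ?_
      rw [hxy]
      simp
    rw [(hT x hx).2.2, (hT y hy).2.2, hxy, map_smul, affineCoord_smul hc]

end LocalPrepotential

/-! ### From symplectic models to prepotential models. -/

section Manifolds

variable {n : ℕ} {M : Type u} [TopologicalSpace M] [ChartedSpace (Model n) M]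

theorem sum_sesquilinear_single {V : Type*} [AddCommGroup V] [Module ℂ V]
    (h : V →ₗ[ℂ] V →ₗ⋆[ℂ] ℂ) (L : Model n →ₗ[ℂ] V) (c : Model n) :
    ∑ α, ∑ β, c α * (starRingEnd ℂ) (c β) * h (L (Pi.single α 1)) (L (Pi.single β 1)) =
      h (L c) (L c) := by
  have hc : L c = ∑ α, c α • L (Pi.single α 1) := by
    conv_lhs => rw [pi_eq_sum_univ' c, map_sum]
    simp only [map_smul]
  rw [hc]
  simp only [map_sum, map_smul, LinearMap.map_smulₛₗ, LinearMap.sum_apply, LinearMap.smul_apply,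
    Finset.mul_sum, smul_eq_mul]
  rw [Finset.sum_comm]
  exact Finset.sum_congr rfl fun α _ => Finset.sum_congr rfl fun β _ => by ring

theorem sum_hermComponent (h : ∀ x : M, TangentSpace 𝓘(ℂ, Model n) x →ₗ[ℂ]
      TangentSpace 𝓘(ℂ, Model n) x →ₗ⋆[ℂ] ℂ)
    (e : OpenPartialHomeomorph M (Model n)) (z : Model n) (c : Model n) :
    ∑ α, ∑ β, c α * (starRingEnd ℂ) (c β) * hermComponent h e α β z =
      h (e.symm z) (mfderiv 𝓘(ℂ, Model n) 𝓘(ℂ, Model n) e.symm z c)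
        (mfderiv 𝓘(ℂ, Model n) 𝓘(ℂ, Model n) e.symm z c) :=
  sum_sesquilinear_single (h (e.symm z))
    (mfderiv 𝓘(ℂ, Model n) 𝓘(ℂ, Model n) e.symm z).toLinearMap c

theorem KahlerMetric.sum_hermComponent_ne_zero (g : KahlerMetric n M)
    {e : OpenPartialHomeomorph M (Model n)} (he : IsHolomorphicChart e) {z : Model n}
    (hz : z ∈ e.target) {c : Model n} (hc : c ≠ 0) :
    ∑ α, ∑ β, c α * (starRingEnd ℂ) (c β) * hermComponent g.form e α β z ≠ 0 := by
  rw [sum_hermComponent]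
  have hmd : e.MDifferentiable 𝓘(ℂ, Model n) 𝓘(ℂ, Model n) :=
    ⟨(contMDiffOn_of_mem_maximalAtlas he).mdifferentiableOn (by simp),
      (contMDiffOn_symm_of_mem_maximalAtlas he).mdifferentiableOn (by simp)⟩
  have hne : mfderiv 𝓘(ℂ, Model n) 𝓘(ℂ, Model n) e.symm z c ≠ 0 := fun h0 =>
    hc (hmd.symm.mfderiv_injective hz (h0.trans (map_zero _).symm))
  intro h0
  have := g.posDef _ _ hne
  rw [h0] at this
  simp at this

/-- The metric is nondegenerate, so a symplectic section and its derivatives are independent. -/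
theorem IsSymplecticSection.linearIndependent {g : KahlerMetric n M} {U : Set M}
    {v : M → SympVec n} (h : IsSymplecticSection g U v) (hU : IsOpen U)
    {e : OpenPartialHomeomorph M (Model n)} (he : IsHolomorphicChart e) {z : Model n}
    (hz : z ∈ e.target ∩ e.symm ⁻¹' U) :
    LinearIndependent ℂ (Fin.cons ((v ∘ e.symm) z) fun α =>
      fderiv ℂ (v ∘ e.symm) z (Pi.single α 1) : Fin (n + 1) → SympVec n) := by
  set w := v ∘ e.symm with hw
  have hO := e.isOpen_inter_preimage_symm hU
  have hN : sympInner (star (w z)) (w z) ≠ 0 := by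
    intro h0
    have := coe_sympNorm (w z)
    rw [h0, mul_zero, Complex.ofReal_eq_zero] at this
    exact (h.norm_pos _ hz.2).ne' this
  rw [Fintype.linearIndependent_iff]
  intro a ha
  rw [Fin.sum_univ_succ] at ha
  simp only [Fin.cons_zero, Fin.cons_succ] at ha
  set c : Model n := fun α => a α.succ with hc
  set u := ∑ α, c α • fderiv ℂ w z (Pi.single α 1) with hu
  have hu' : u = -a 0 • w z := by
    rw [neg_smul]
    exact eq_neg_of_add_eq_zero_right ha
  -- Up to the factor `⟨w̄, w⟩²`, the metric on `c` is `-⟨ū, u⟩⟨w̄, w⟩ + ⟨ū, w⟩⟨w̄, u⟩`. This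
  -- vanishes when `u` is a multiple of `w`, against positivity unless `c = 0`.
  have hc0 : c = 0 := by
    by_contra hne
    refine g.sum_hermComponent_ne_zero he hz.1 hne ?_
    have hmet : ∀ α β, hermComponent g.form e α β z * sympInner (star (w z)) (w z) ^ 2 =
        -sympInner (star (fderiv ℂ w z (Pi.single β 1))) (fderiv ℂ w z (Pi.single α 1)) *
            sympInner (star (w z)) (w z) +
          sympInner (star (fderiv ℂ w z (Pi.single β 1))) (w z) *
            sympInner (star (w z)) (fderiv ℂ w z (Pi.single α 1)) := fun α β =>
      (congrArg (· * _) ((h.potential e he).2 z hz α β)).trans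
        (wirtinger_wirtingerBar_neg_log_sympNorm hO (h.holomorphic.comp_symm he)
          (fun y hy => h.norm_pos _ hy.2) hz α β)
    refine (mul_eq_zero.mp ?_).resolve_right (pow_ne_zero 2 hN)
    have h1 : sympInner (star u) u = ∑ α, ∑ β, c α * (starRingEnd ℂ) (c β) *
        sympInner (star (fderiv ℂ w z (Pi.single β 1))) (fderiv ℂ w z (Pi.single α 1)) := by
      rw [hu, star_sum, sympInner_sum_right]
      refine Finset.sum_congr rfl fun α _ => ?_
      rw [sympInner_sum_left]
      refine Finset.sum_congr rfl fun β _ => ?_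
      rw [star_smul, sympInner_smul_left, sympInner_smul_right, starRingEnd_apply]
      ring
    have h2 : sympInner (star u) (w z) * sympInner (star (w z)) u =
        ∑ α, ∑ β, c α * (starRingEnd ℂ) (c β) *
        (sympInner (star (fderiv ℂ w z (Pi.single β 1))) (w z) *
          sympInner (star (w z)) (fderiv ℂ w z (Pi.single α 1))) := by
      rw [hu, star_sum, sympInner_sum_right, sympInner_sum_left, Finset.sum_mul_sum,
        Finset.sum_comm]
      refine Finset.sum_congr rfl fun α _ => Finset.sum_congr rfl fun β _ => ?_
      rw [star_smul, sympInner_smul_left, sympInner_smul_right, starRingEnd_apply]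
      ring
    have h3 : (∑ α, ∑ β, c α * (starRingEnd ℂ) (c β) * hermComponent g.form e α β z) *
        sympInner (star (w z)) (w z) ^ 2 =
        -sympInner (star u) u * sympInner (star (w z)) (w z) +
          sympInner (star u) (w z) * sympInner (star (w z)) u := by
      rw [h1, h2, neg_mul, Finset.sum_mul, Finset.sum_mul, ← Finset.sum_neg_distrib,
        ← Finset.sum_add_distrib]
      refine Finset.sum_congr rfl fun α _ => ?_
      rw [Finset.sum_mul, Finset.sum_mul, ← Finset.sum_neg_distrib, ← Finset.sum_add_distrib]
      refine Finset.sum_congr rfl fun β _ => ?_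
      rw [mul_assoc, hmet]
      ring
    rw [h3, hu', star_smul]
    simp only [sympInner_smul_left, sympInner_smul_right]
    ring
  have ha0 : a 0 = 0 := by
    have hu0 : u = 0 := by simp [hu, hc0]
    rw [hu0] at hu'
    have hw0 : w z ≠ 0 := fun h0 => hN (by rw [h0]; simp [sympInner])
    simpa [hw0] using hu'.symm
  exact fun i => Fin.cases ha0 (fun α => congrFun hc0 α) i

/-- Locally, a constant symplectic rotation brings a symplectic section to the form
`(X, ∂F/∂X)`. -/
theorem IsSymplecticSection.exists_isPrepotentialChart [IsManifold 𝓘(ℂ, Model n) ω M]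
    {g : KahlerMetric n M} {U : Set M} {v : M → SympVec n} (h : IsSymplecticSection g U v)
    (hU : IsOpen U) {p : M} (hp : p ∈ U) :
    ∃ (S : Sp n) (e : OpenPartialHomeomorph M (Model n)) (X : M → Fin (n + 1) → ℂ)
      (D : Set (Fin (n + 1) → ℂ)) (F : (Fin (n + 1) → ℂ) → ℂ),
      p ∈ e.source ∧ e.source ⊆ U ∧ IsPrepotentialChart g e X D F ∧
      ∀ x ∈ e.source, rotate S (v x) = prepotentialVec F (X x) := by
  set e₀ := chartAt (Model n) p with he₀
  have he : IsHolomorphicChart e₀ := IsManifold.chart_mem_maximalAtlas p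
  have hp₀ : p ∈ e₀.source := mem_chart_source _ p
  set O := e₀.target ∩ e₀.symm ⁻¹' U with hOdef
  have hO : IsOpen O := e₀.isOpen_inter_preimage_symm hU
  have hpO : e₀ p ∈ O :=
    ⟨e₀.map_source hp₀, by rw [Set.mem_preimage, e₀.left_inv hp₀]; exact hp⟩
  have hv : DifferentiableOn ℂ (v ∘ e₀.symm) O := h.holomorphic.comp_symm he
  have hvd : ∀ z ∈ O, DifferentiableAt ℂ (v ∘ e₀.symm) z := fun z hz =>
    hv.differentiableAt (hO.mem_nhds hz)
  have hhor : ∀ z ∈ O, ∀ α,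
      sympInner ((v ∘ e₀.symm) z) (fderiv ℂ (v ∘ e₀.symm) z (Pi.single α 1)) = 0 := by
    intro z hz α
    have := h.inner_deriv e₀ he (e₀.symm z) ⟨e₀.map_target hz.1, hz.2⟩ α
    rwa [coordDeriv, e₀.right_inv hz.1] at this
  obtain ⟨S, hS⟩ := exists_det_rotate_ne_zero _ (h.linearIndependent hU he hpO) fun i j => by
    refine Fin.cases ?_ (fun α => ?_) i <;> refine Fin.cases ?_ (fun β => ?_) j
    · rw [sympInner_eq]
      exact Finset.sum_eq_zero fun I _ => by ring
    · exact hhor _ hpO β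
    · rw [sympInner_swap, neg_eq_zero]
      exact hhor _ hpO α
    · exact sympInner_fderiv_fderiv_eq_zero hO hv (fun z hz => hhor z hz α)
        (fun z hz => hhor z hz β) hpO
  set w : Model n → SympVec n := fun z => rotateL S ((v ∘ e₀.symm) z) with hw
  have hwd : DifferentiableOn ℂ w O := (rotateL S).differentiable.comp_differentiableOn hv
  have hwf : ∀ z ∈ O, ∀ u, fderiv ℂ w z u = rotate S (fderiv ℂ (v ∘ e₀.symm) z u) :=
    fun z hz u => congrArg (fun L => L u)
      ((rotateL S).hasFDerivAt.comp z (hvd z hz).hasFDerivAt).fderiv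
  have hXf : ∀ z ∈ O, ∀ u, fderiv ℂ (fun z I => w z (Sum.inl I)) z u =
      fun I => fderiv ℂ w z u (Sum.inl I) := fun z hz u => by
    have hA := hasFDerivAt_pi'.mp (hwd.differentiableAt (hO.mem_nhds hz)).hasFDerivAt
    rw [(hasFDerivAt_pi.mpr fun I => hA (Sum.inl I)).fderiv]
    rfl
  obtain ⟨N, D, F, hNo, hpN, hNO, hF, hN, hinj⟩ := exists_prepotential hO hwd
    (fun z hz α => by
      rw [hwf z hz, hw]
      exact (sympInner_rotate S _ _).trans (hhor z hz α)) hpO (by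
      convert hS using 2
      ext i I
      refine Fin.cases rfl (fun α => ?_) i
      simp only [frameMatrix, Matrix.of_apply, Fin.cons_succ]
      rw [hXf _ hpO, hwf _ hpO])
  set s := e₀.source ∩ e₀ ⁻¹' N with hs
  have hso : IsOpen s := e₀.isOpen_inter_preimage hNo
  set e := e₀.restr s with hedef
  have hes : e.source = s := by
    rw [hedef, OpenPartialHomeomorph.restr_source' _ _ hso, hs]
    exact Set.inter_eq_right.mpr Set.inter_subset_left
  have hsU : s ⊆ U := fun x hx => by
    have := (hNO hx.2).2
    rwa [Set.mem_preimage, e₀.left_inv hx.1] at this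
  have hwx : ∀ x ∈ s, w (e₀ x) = rotate S (v x) := fun x hx => by
    simp [hw, e₀.left_inv hx.1]
  set X : M → Fin (n + 1) → ℂ := fun x I => rotate S (v x) (Sum.inl I) with hX
  have hXx : ∀ x ∈ s, X x = fun I => w (e₀ x) (Sum.inl I) := fun x hx => by rw [hwx x hx]
  have hvec : ∀ x ∈ s, rotate S (v x) = prepotentialVec F (X x) := fun x hx => by
    rw [hXx x hx, ← hwx x hx]
    exact (hN _ hx.2).2.2
  have hnorm : ∀ x ∈ s, prepotentialNorm F (X x) = sympNorm (v x) := fun x hx => by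
    rw [← sympNorm_prepotentialVec, ← hvec x hx, sympNorm_rotate]
  refine ⟨S, e, X, D, F, by rw [hes]; exact ⟨hp₀, hpN⟩, by rwa [hes],
    ⟨restr_mem_maximalAtlas _ he hso, ⟨?_, ?_, ?_⟩, hF, ?_, ?_, ?_⟩, by rwa [hes]⟩ <;> rw [hes]
  · have hG : Differentiable ℂ fun (y : SympVec n) I => rotateL S y (Sum.inl I) :=
      differentiable_pi.mpr fun I => differentiable_pi.mp (rotateL S).differentiable (Sum.inl I)
    exact HolomorphicOn.postcomp hG.differentiableOn (h.holomorphic.mono hsU) (Set.mapsTo_univ _ _)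
  · intro x hx
    convert (hN _ hx.2).2.1 using 2
    rw [frameMatrix, hXx x hx]
    rfl
  · intro x hx y hy c hxy
    rw [hXx x hx, hXx y hy] at hxy
    exact e₀.injOn hx.1 hy.1 (hinj _ hx.2 _ hy.2 c hxy)
  · intro x hx
    rw [hXx x hx]
    exact (hN _ hx.2).1
  · intro x hx
    rw [hnorm x hx]
    exact h.norm_pos x (hsU hx)
  · exact h.potential.mono_congr hso hsU fun x hx => by rw [hnorm x hx]

/-- Every symplectic model is locally rotated to a prepotential model. -/
theorem SymplecticModel.exists_prepotentialModel [IsManifold 𝓘(ℂ, Model n) ω M]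
    {g : KahlerMetric n M} (Q : SymplecticModel g) :
    ∃ (P : PrepotentialModel g) (a : P.ι → Q.ι) (R : P.ι → Sp n),
      (∀ i, (P.chart i).source ⊆ Q.U (a i)) ∧
      (∀ i, ∀ x ∈ (P.chart i).source,
        prepotentialVec (P.F i) (P.Z i x) = rotate (R i) (Q.v (a i) x)) ∧
      ∀ i j, ((P.chart i).source ∩ (P.chart j).source).Nonempty →
        P.bundle.S i j = R i * Q.bundle.S (a i) (a j) * (R j)⁻¹ ∧
        ∀ x ∈ (P.chart i).source ∩ (P.chart j).source,
          P.bundle.f i j x = Q.bundle.f (a i) (a j) x := by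
  choose a ha using Q.cover
  -- The new cover is indexed by the points of `M`, with one rotated chart around each.
  choose R e X D F hp hsub hchart hvec using fun p =>
    (Q.isSection (a p)).exists_isPrepotentialChart (Q.isOpen (a p)) (ha p)
  let B : SymplecticBundle (n := n) fun p => (e p).source :=
    { f := fun i j => Q.bundle.f (a i) (a j)
      S := fun i j => R i * Q.bundle.S (a i) (a j) * (R j)⁻¹
      holomorphic := fun i j => (Q.bundle.holomorphic (a i) (a j)).mono
        (Set.inter_subset_inter (hsub i) (hsub j))
      cocycle_f := fun i j k x hx => Q.bundle.cocycle_f _ _ _ x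
        ⟨⟨hsub i hx.1.1, hsub j hx.1.2⟩, hsub k hx.2⟩
      cocycle_S := fun i j k ⟨x, hx⟩ => by
        rw [← Q.bundle.cocycle_S (a i) (a j) (a k)
          ⟨x, ⟨hsub i hx.1.1, hsub j hx.1.2⟩, hsub k hx.2⟩]
        group }
  let P : PrepotentialModel g :=
    { ι := M
      chart := e
      cover := fun x => ⟨x, hp x⟩
      Z := X
      D := D
      F := F
      isPrepotential := hchart
      bundle := B
      glues := fun i j x hx => by
        change prepotentialVec (F i) (X i x) = Complex.exp (Q.bundle.f (a i) (a j) x) •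
          rotate (R i * Q.bundle.S (a i) (a j) * (R j)⁻¹) (prepotentialVec (F j) (X j x))
        -- In terms of `v` the factor `R_j⁻¹ R_j` cancels, leaving `R_i` applied to the old gluing
        -- relation.
        rw [← hvec i x hx.1, ← hvec j x hx.2, ← rotate_mul, inv_mul_cancel_right, rotate_mul,
          ← rotate_smul, ← Q.glues (a i) (a j) x ⟨hsub i hx.1, hsub j hx.2⟩] }
  exact ⟨P, a, R, hsub, fun i x hx => (hvec i x hx).symm, fun i j _ => ⟨rfl, fun _ _ => rfl⟩⟩

end Manifolds

end SpecialGeometry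

open SpecialGeometry in
theorem mainTheorem1 {n : ℕ} {M : Type*} [TopologicalSpace M] [T2Space M]
    [SecondCountableTopology M] [ChartedSpace (Model n) M]
    [IsManifold 𝓘(ℂ, Model n) ω M] (g : KahlerMetric n M) :
    -- the two definitions are equivalent
    (IsSpecialByPrepotential g ↔ IsSpecialBySection g) ∧
    -- locally, a constant rotation brings a section to the form `(X, ∂F/∂X)`
    (∀ (U : Set M) (v : M → SympVec n), IsOpen U → IsSymplecticSection g U v → ∀ p ∈ U,
      ∃ (S : Sp n) (e : OpenPartialHomeomorph M (Model n)) (X : M → Fin (n + 1) → ℂ)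
        (D : Set (Fin (n + 1) → ℂ)) (F : (Fin (n + 1) → ℂ) → ℂ),
        p ∈ e.source ∧ e.source ⊆ U ∧ IsPrepotentialChart g e X D F ∧
        ∀ x ∈ e.source, rotate S (v x) = prepotentialVec F (X x)) ∧
    -- every model given by a section is a symplectic rotation of one with a prepotential:
    -- the same section of the same bundle, in locally rotated frames
    (∀ Q : SymplecticModel g, ∃ (P : PrepotentialModel g) (a : P.ι → Q.ι) (R : P.ι → Sp n),
      (∀ i, (P.chart i).source ⊆ Q.U (a i)) ∧
      (∀ i, ∀ x ∈ (P.chart i).source,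
        prepotentialVec (P.F i) (P.Z i x) = rotate (R i) (Q.v (a i) x)) ∧
      ∀ i j, ((P.chart i).source ∩ (P.chart j).source).Nonempty →
        P.bundle.S i j = R i * Q.bundle.S (a i) (a j) * (R j)⁻¹ ∧
        ∀ x ∈ (P.chart i).source ∩ (P.chart j).source,
          P.bundle.f i j x = Q.bundle.f (a i) (a j) x) ∧
    -- every vector `(Z, ∂F)` of a prepotential is a symplectic section
    (∀ P : PrepotentialModel g, ∃ Q : SymplecticModel g, ∃ a : P.ι ≃ Q.ι,
      ∀ i, Q.U (a i) = (P.chart i).source ∧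
        (∀ x ∈ (P.chart i).source, Q.v (a i) x = prepotentialVec (P.F i) (P.Z i x)) ∧
        ∀ j, Q.bundle.S (a i) (a j) = P.bundle.S i j ∧
          ∀ x ∈ (P.chart i).source ∩ (P.chart j).source,
            Q.bundle.f (a i) (a j) x = P.bundle.f i j x) := by
  exact ⟨⟨fun h => ⟨h.1, h.2.map PrepotentialModel.toSymplecticModel⟩,
      fun h => ⟨h.1, h.2.elim fun Q => ⟨Q.exists_prepotentialModel.choose⟩⟩⟩,
    fun _ _ hU hv _ hp => hv.exists_isPrepotentialChart hU hp,
    fun Q => Q.exists_prepotentialModel,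
    fun P => ⟨P.toSymplecticModel, Equiv.refl _,
      fun _ => ⟨rfl, fun _ _ => rfl, fun _ => ⟨rfl, fun _ _ => rfl⟩⟩⟩⟩
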